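/- Let $B\subseteq\mathbb R^d$ be Polish (in the subspace topology), with the Euclidean metric. Let $\Gamma_B$ be the space of simple counting measures $\xi=\sum_{x\in S}\delta_x$ on $B$ with finitely many atoms in each bounded set, with the $\sigma$-algebra generated by $\xi\mapsto\xi(D)$, $D$ Borel. A *test function* is a bounded continuous $f:B\to\mathbb R$ vanishing outside a bounded set (for closed $B$: a continuous function with compact support). $\Gamma_B$ carries the vague topology, generated by $\xi\mapsto\int f\,d\xi$, $f$ a test function. Let $\mathcal P_1(\Gamma_B)$ be the set of probability measures $\mathbf P$ on $\Gamma_B$ with $\int\xi(D)\,\mathbf P(d\xi)<\infty$ for all bounded Borel $D\subseteq B$, with the topology generated by $\mathbf P\mapsto\int F\,d\mathbf P$, where $F$ is continuous with $|F(\xi)|\le c(1+\int f\,d\xi)$ for some $c>0$ and some test function $f$. Let $\mathcal M_{b,0}(\Gamma_B\times B)$ be the set of signed measures $\mathbf V$ on $\Gamma_B\times B$ (defined on measurable subsets of $\Gamma_B\times D$, $D$ bounded) with $|\mathbf V|(\Gamma_B\times D)<\infty$ for all bounded Borel $D\subseteq B$. Put $D_zF(\xi)=F(\xi+\delta_z)-F(\xi)$.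 For $\mathbf P_0,\mathbf P_1\in\mathcal P_1(\Gamma_B)$ let $\mathcal{CE}^B(\mathbf P_0,\mathbf P_1)$ be the set of pairs of curves $(\bar{\mathbf P}_t)_{t\in[0,1]}\subset\mathcal P_1(\Gamma_B)$, $(\bar{\mathbf V}_t)_{t\in[0,1]}\subset\mathcal M_{b,0}(\Gamma_B\times B)$ such that $\bar{\mathbf P}$ is continuous from $\mathbf P_0$ at $t=0$ to $\mathbf P_1$ at $t=1$; $\int_0^1|\bar{\mathbf V}_t|(\Gamma_B\times D)\,dt<\infty$ for all bounded Borel $D\subseteq B$; and for all test functions $f\ge0$ and all $\phi\in C_c^\infty((0,1))$ $$\int_0^1\phi'(t)\int e^{-\int f\,d\xi}\,\bar{\mathbf P}_t(d\xi)\,dt+\int_0^1\phi(t)\int D_ze^{-\int f\,d\xi}\,\bar{\mathbf V}_t(d\xi,dz)\,dt=0$$ (in particular, the time integrals exist). For independent $\eta_0\sim\mathbf P_0$ and $\eta_1\sim\mathbf P_1$ and $t\in[0,1]$ write $\zeta^{p}$ for the thinning of $\zeta$ that keeps each point independently with probability $p$; all thinnings are independent. The *thinning interpolation* is the pair in which $\bar{\mathbf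 P}_t$ is the law of $\eta_0^{1-t}+\eta_1^{t}$ and, for measurable $K\subseteq\Gamma_B$ and bounded Borel $D\subseteq B$, $$\bar{\mathbf V}_t(K\times D)=\mathbb E\sum_{y\in\eta_1\cap D}\mathbf 1_K\big(\eta_0^{1-t}+(\eta_1-\delta_y)^{t}\big)-\mathbb E\sum_{x\in\eta_0\cap D}\mathbf 1_K\big((\eta_0-\delta_x)^{1-t}+\eta_1^{t}\big).$$ **Theorem.** 1. For every Polish $B\subseteq\mathbb R^d$ and all $\mathbf P_0,\mathbf P_1\in\mathcal P_1(\Gamma_B)$, the set $\mathcal{CE}^B(\mathbf P_0,\mathbf P_1)$ is non-empty. If moreover independent $\eta_0\sim\mathbf P_0$ and $\eta_1\sim\mathbf P_1$ almost surely have no common point (so that $\eta_0+\eta_1$ is simple), then the thinning interpolation belongs to it. 2. Let $B=\mathbb R^d$ and let $\mathbf P_0,\mathbf P_1\in\mathcal P_1(\Gamma_{\mathbb R^d})$ be stationary, that is, invariant under all shifts $\Theta_z\xi=\xi(\cdot+z)$. Then there is $(\bar{\mathbf P},\bar{\mathbf V})\in\mathcal{CE}^{\mathbb R^d}(\mathbf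 P_0,\mathbf P_1)$ such that, for all $t\in[0,1]$, $\bar{\mathbf V}_t$ is invariant under all maps $(\xi,x)\mapsto(\Theta_z\xi,x-z)$, $z\in\mathbb R^d$, and $\bar{\mathbf P}_t$ is stationary. If $d\ge1$, the thinning interpolation has these properties. -/

import Mathlib

open MeasureTheory Set Filter Topology

noncomputable section

namespace PointProcess

/-! ### Configurations

Throughout, `X` is the state space: a Polish subset `B` of `ℝ^d` with the metric of `ℝ^d`,
or `ℝ^d` itself. -/

/-- A simple locally finite counting measure `∑_{x ∈ S} δ_x`, recorded by its set `S` of atoms;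
locally finite means: finitely many atoms in each bounded set.  The type `Config B` is `Γ_B`. -/
@[ext]
structure Config (X : Type*) [PseudoMetricSpace X] where
  carrier : Set X
  finite_inter : ∀ D : Set X, Bornology.IsBounded D → (carrier ∩ D).Finite

section Basic

variable {X : Type*} [PseudoMetricSpace X]

/-- The sub-configuration of those points of `ξ` that lie in `A`. -/
def Config.restrict (ξ : Config X) (A : Set X) : Config X where
  carrier := ξ.carrier ∩ A
  finite_inter := fun D hD =>
    (ξ.finite_inter D hD).subset fun _ hx => ⟨hx.1.1, hx.2⟩

/-- `ξ - δ_z` for a point `z` of `ξ`. -/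
def Config.erase (ξ : Config X) (z : X) : Config X := ξ.restrict {z}ᶜ

variable [MeasurableSpace X]

/-- The counting measure `∑_{x ∈ ξ} δ_x`. -/
def Config.toMeasure (ξ : Config X) : Measure X :=
  Measure.sum fun x : ξ.carrier => Measure.dirac (x : X)

/-- A configuration is determined by its counting measure. -/
theorem Config.toMeasure_injective [MeasurableSingletonClass X] :
    Function.Injective (Config.toMeasure : Config X → Measure X) := by
  have key : ∀ (ξ : Config X) (z : X), ξ.toMeasure {z} = 0 ↔ z ∉ ξ.carrier := by
    intro ξ z
    rw [Config.toMeasure, Measure.sum_apply _ (measurableSet_singleton z), ENNReal.tsum_eq_zero]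
    constructor
    · intro h hz
      simpa using h ⟨z, hz⟩
    · rintro hz ⟨x, hx⟩
      have hxz : x ≠ z := fun h => hz (h ▸ hx)
      simp [hxz]
  intro ξ ζ h
  ext z
  rw [← not_iff_not, ← key ξ z, ← key ζ z, h]

/-- The `σ`-algebra on configurations generated by the counts `ξ ↦ ξ(D)`, `D` measurable. -/
instance : MeasurableSpace (Config X) :=
  MeasurableSpace.comap Config.toMeasure inferInstance

end Basic

/-! ### Test functions, the vague topology, laws of point processes -/

section Laws

variable {X : Type*} [PseudoMetricSpace X]

/-- Test functions on `X`: bounded continuous functions that vanish outside a bounded set.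
On `ℝ^d` and on closed subsets of `ℝ^d` these are exactly the continuous functions with compact
support; on any other `X` they include all of the latter. -/
def IsTestFunction (f : X → ℝ) : Prop :=
  Continuous f ∧ (∃ C : ℝ, ∀ x, |f x| ≤ C) ∧
    ∃ D : Set X, Bornology.IsBounded D ∧ ∀ x, x ∉ D → f x = 0

theorem isTestFunction_of_hasCompactSupport {f : X → ℝ} (hf : Continuous f)
    (hc : HasCompactSupport f) : IsTestFunction f := by
  obtain ⟨C, hC⟩ := hc.exists_bound_of_continuous hf
  exact ⟨hf, ⟨C, hC⟩, tsupport f, hc.isCompact.isBounded, fun x hx => image_eq_zero_of_notMem_tsupport hx⟩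

theorem isTestFunction_iff [ProperSpace X] {f : X → ℝ} :
    IsTestFunction f ↔ Continuous f ∧ HasCompactSupport f := by
  refine ⟨fun h => ⟨h.1, ?_⟩, fun h => isTestFunction_of_hasCompactSupport h.1 h.2⟩
  obtain ⟨D, hD, hz⟩ := h.2.2
  exact HasCompactSupport.intro (Metric.isCompact_of_isClosed_isBounded isClosed_closure hD.closure)
    fun x hx => hz x fun h' => hx (subset_closure h')

variable [MeasurableSpace X]

/-- The vague topology, generated by the maps `ξ ↦ ∫ f dξ`, `f` a test function. -/
instance : TopologicalSpace (Config X) :=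
  TopologicalSpace.induced
    (fun (ξ : Config X) (f : {f : X → ℝ // IsTestFunction f}) => ∫ x, f.1 x ∂ξ.toMeasure)
    inferInstance

/-- `𝒞₁(Γ_X)`: the continuous (and measurable) functions of sublinear growth. -/
def IsContinuousSublinear (F : Config X → ℝ) : Prop :=
  Measurable F ∧ Continuous F ∧
    ∃ c : ℝ, 0 < c ∧ ∃ f : X → ℝ, IsTestFunction f ∧
      ∀ ξ : Config X, |F ξ| ≤ c * (1 + ∫ x, f x ∂ξ.toMeasure)

variable (X) in
/-- `𝒫₁(Γ_X)`: locally integrable probability measures on the configuration space. -/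
@[ext]
structure Law where
  measure : Measure (Config X)
  isProbabilityMeasure : IsProbabilityMeasure measure
  locallyIntegrable : ∀ D : Set X, MeasurableSet D → Bornology.IsBounded D →
    ∫⁻ ξ, ξ.toMeasure D ∂measure < ⊤

/-- The topology of `𝒫₁(Γ_X)`, generated by the maps `P ↦ ∫ F dP`, `F ∈ 𝒞₁(Γ_X)`. -/
instance : TopologicalSpace (Law X) :=
  TopologicalSpace.induced
    (fun (P : Law X) (F : {F : Config X → ℝ // IsContinuousSublinear F}) =>
      ∫ ξ, F.1 ξ ∂P.measure)
    inferInstance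

/-! ### Velocity fields -/

variable (X) in
/-- `ℳ_{b,0}(Γ_X × X)`: signed measures `V` on `Γ_X × X` whose total variation is finite on
`Γ_X × D` for every bounded `D`.  The total mass may be infinite, also for both signs, so `V` is
recorded by its Jordan decomposition `V = pos - neg`. -/
structure Velocity where
  pos : Measure (Config X × X)
  neg : Measure (Config X × X)
  mutuallySingular : pos ⟂ₘ neg
  finite_pos : ∀ D : Set X, MeasurableSet D → Bornology.IsBounded D → pos (univ ×ˢ D) < ⊤
  finite_neg : ∀ D : Set X, MeasurableSet D → Bornology.IsBounded D → neg (univ ×ˢ D) < ⊤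

/-- The total variation measure `|V|`. -/
def Velocity.totalVariation (V : Velocity X) : Measure (Config X × X) := V.pos + V.neg

/-- The value `V(S)`, for measurable `S ⊆ Γ_X × D` with `D` bounded. -/
def Velocity.value (V : Velocity X) (S : Set (Config X × X)) : ℝ :=
  (V.pos S).toReal - (V.neg S).toReal

/-- The integral `∫ G dV`. -/
def Velocity.integral (V : Velocity X) (G : Config X × X → ℝ) : ℝ :=
  ∫ q, G q ∂V.pos - ∫ q, G q ∂V.neg

/-! ### The continuity equation -/

/-- The functional `μ ↦ exp (-∫ f dμ)`.  It is defined on all measures, since `ξ + δ_z` need not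
be simple. -/
def expFunctional (f : X → ℝ) (μ : Measure X) : ℝ := Real.exp (-∫ x, f x ∂μ)

/-- The discrete difference `D_z F(ξ) = F(ξ + δ_z) - F(ξ)`. -/
def addOneCost (F : Measure X → ℝ) (q : Config X × X) : ℝ :=
  F (q.1.toMeasure + Measure.dirac q.2) - F q.1.toMeasure

/-- `(P, V) ∈ 𝒞ℰ^X(P₀, P₁)`.  Curves on `[0,1]` are given as functions on `ℝ`, of which only the
values on `[0,1]` matter. -/
structure IsSolution (P₀ P₁ : Law X) (P : ℝ → Law X) (V : ℝ → Velocity X) : Prop where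
  source : P 0 = P₀
  target : P 1 = P₁
  continuousOn : ContinuousOn P (Icc 0 1)
  /-- The time integrals in the continuity equation exist. -/
  integrable : ∀ f : X → ℝ, IsTestFunction f → (∀ x, 0 ≤ f x) →
    IntegrableOn (fun t => (V t).integral (addOneCost (expFunctional f))) (Icc 0 1)
  continuityEquation : ∀ f : X → ℝ, IsTestFunction f → (∀ x, 0 ≤ f x) →
    ∀ φ : ℝ → ℝ, ContDiff ℝ (⊤ : ℕ∞) φ → HasCompactSupport φ → tsupport φ ⊆ Ioo 0 1 →
      (∫ t in (0 : ℝ)..1, deriv φ t * ∫ ξ, expFunctional f ξ.toMeasure ∂(P t).measure) +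
        (∫ t in (0 : ℝ)..1, φ t * (V t).integral (addOneCost (expFunctional f))) = 0
  aemeasurable_totalVariation : ∀ D : Set X, MeasurableSet D → Bornology.IsBounded D →
    AEMeasurable (fun t => (V t).totalVariation (univ ×ˢ D)) (volume.restrict (Icc (0 : ℝ) 1))
  lintegral_totalVariation : ∀ D : Set X, MeasurableSet D → Bornology.IsBounded D →
    ∫⁻ t in Icc (0 : ℝ) 1, (V t).totalVariation (univ ×ˢ D) < ⊤

/-! ### Independent superposition of thinnings -/

/-- The law of the thinning of `ξ` that keeps each point independently with probability `p`. -/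
def thinning (p : unitInterval) (ξ : Config X) : Measure (Config X) :=
  (ProbabilityTheory.setBernoulli (univ : Set ξ.carrier) p).map
    fun s => ξ.restrict (Subtype.val '' s)

/-- The law of the random measure `ξ' + ζ'`, where `ξ'`, `ζ'` are independent thinnings of `ξ`, `ζ`
with retention probabilities `p`, `q`. -/
def thinnedSum (p q : unitInterval) (ξ ζ : Config X) : Measure (Measure X) :=
  ((thinning p ξ).prod (thinning q ζ)).map fun a => a.1.toMeasure + a.2.toMeasure

/-- `(P, V)` is the explicit interpolation: with independent `η₀ ∼ P₀`, `η₁ ∼ P₁`, thinned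
independently with retention probabilities `1 - t` and `t`,
* `P t` is the law of `η₀' + η₁'`;
* `V t (K × D) = 𝔼 ∑_{y ∈ η₁ ∩ D} 1_K (η₀' + (η₁ - δ_y)')
    - 𝔼 ∑_{x ∈ η₀ ∩ D} 1_K ((η₀ - δ_x)' + η₁')`.

Events `K` are preimages of measurable sets of measures, which are all the measurable sets of
configurations. -/
structure IsThinningInterpolation (P₀ P₁ : Law X) (P : ℝ → Law X) (V : ℝ → Velocity X) : Prop where
  law : ∀ t : unitInterval, ∀ K : Set (Measure X), MeasurableSet K →
    (P t).measure (Config.toMeasure ⁻¹' K) =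
      ∫⁻ ξ, ∫⁻ ζ, thinnedSum (unitInterval.symm t) t ξ ζ K ∂P₁.measure ∂P₀.measure
  velocity : ∀ t : unitInterval, ∀ K : Set (Measure X), MeasurableSet K →
    ∀ D : Set X, MeasurableSet D → Bornology.IsBounded D →
      (V t).value ((Config.toMeasure ⁻¹' K) ×ˢ D) =
        (∫⁻ ξ, ∫⁻ ζ, ∫⁻ y in D, thinnedSum (unitInterval.symm t) t ξ (ζ.erase y) K
          ∂ζ.toMeasure ∂P₁.measure ∂P₀.measure).toReal -
        (∫⁻ ξ, ∫⁻ ζ, ∫⁻ x in D, thinnedSum (unitInterval.symm t) t (ξ.erase x) ζ K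
          ∂ξ.toMeasure ∂P₁.measure ∂P₀.measure).toReal

/-- Almost surely, independent `η₀ ∼ P₀` and `η₁ ∼ P₁` have no common point, in other words,
`η₀ + η₁` is simple. -/
def AlmostSurelyDisjoint (P₀ P₁ : Law X) : Prop :=
  ∀ᵐ q ∂(P₀.measure.prod P₁.measure), Disjoint q.1.carrier q.2.carrier

end Laws

/-! ### Stationarity -/

section Stationary

variable {E : Type*} [NormedAddCommGroup E]

/-- The shift `Θ_z`, `Θ_z ξ (A) = ξ (A + z)`. -/
def Config.shift (z : E) (ξ : Config E) : Config E where
  carrier := {x | x + z ∈ ξ.carrier}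
  finite_inter := fun D hD => by
    have hb : Bornology.IsBounded ((fun x => x + z) '' D) :=
      (LipschitzWith.of_dist_le_mul (K := 1) (f := fun x : E => x + z)
        (fun x y => by simp)).isBounded_image hD
    refine Set.Finite.of_finite_image (f := fun x => x + z)
      ((ξ.finite_inter _ hb).subset ?_) (add_left_injective z).injOn
    rintro _ ⟨x, hx, rfl⟩
    exact ⟨hx.1, x, hx.2, rfl⟩

variable [MeasurableSpace E]

/-- The law of a stationary point process. -/
def Law.IsStationary (P : Law E) : Prop :=
  ∀ z : E, P.measure.map (Config.shift z) = P.measure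

/-- `V` is invariant under all `(ξ, x) ↦ (Θ_z ξ, x - z)`.  These are bimeasurable bijections, so
they act on `V` by acting on both parts of the Jordan decomposition. -/
def Velocity.IsStationary (V : Velocity E) : Prop :=
  ∀ z : E, V.pos.map (fun q => (q.1.shift z, q.2 - z)) = V.pos ∧
    V.neg.map (fun q => (q.1.shift z, q.2 - z)) = V.neg

/-- `(P, V) ∈ 𝒞ℰ^s(P₀, P₁)`: a solution with stationary velocity field. -/
structure IsStationarySolution (P₀ P₁ : Law E) (P : ℝ → Law E) (V : ℝ → Velocity E) : Prop
    extends IsSolution P₀ P₁ P V where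
  stationary : ∀ t ∈ Icc (0 : ℝ) 1, (V t).IsStationary

end Stationary

end PointProcess

end

open scoped ENNReal unitInterval NNReal
open ProbabilityTheory

set_option linter.unusedSectionVars false

namespace PointProcess

/-! ### Counts of points and void events -/

section Counting

variable {X : Type*} [MetricSpace X]

/-! Thin independent configurations of laws `P₀` and `P₁` with retention probabilities `p t`,
decreasing from `1` to `0` at speed `a t`, and `q t`, increasing from `0` to `1` at speed `b t`, and
let `P t` be the law of the superposition. Thinning with retention `s` turns the Laplace functional
of a configuration `ξ` into `∏ x ∈ ξ, (1 - s (1 - e^{-f x}))`. As long as the two thinnings have no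
common point, the Laplace functional of `P t` is therefore the product `L₀ (p t) * L₁ (q t)` of two
averages of such expressions.

By the product rule, differentiating in `s` gives minus the sum over points `y` of `(1 - e^{-f y})`
times the same product for `ξ - δ_y` (`hasDerivAt_thinLaplace`). Since `D_y e^{-∫ f dη} = -e^{-∫ f
dη} (1 - e^{-f y})`, this is the integral of `D_y e^{-∫ f dη}` for the mechanism that picks a point
`y`, erases it, thins the rest to `η` and records `(η, y)`: this is `birthKernel`, and the match is
`birthIntegral_addOneCost`. Points of the second configuration are born at speed `b`, and points of
the first one die at speed `a`. A death is a birth with the opposite sign and the two laws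
exchanged, so `V t = b t • birthKernel P₀ P₁ - a t • birthKernel P₁ P₀`. The weak equation follows
by integrating by parts against `φ`.

Both terms of `V t` can have infinite mass, so the difference is encoded by `pos + deaths = neg +
births`. A Jordan decomposition measurable in `t` comes from Radon-Nikodym derivatives of kernels,
after weighting by a positive function that makes everything finite
(`exists_kernel_jordanDecomposition`, `exists_weight`).

Common points are the only obstruction. If they almost surely do not occur, `p = 1 - t` and `q = t`
give the thinning interpolation. Otherwise the first configuration is removed during the first half
of the time and the second one added during the second half; then one of `p`, `q` is always zero and
nothing can collide. For stationary laws on a nontrivial space, the intensity measure gives equal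
mass to all points and finite mass to bounded sets, hence has no atoms, and Fubini excludes common
points. Thinning and erasing commute with shifts, and uniqueness of the Jordan decomposition passes
invariance on to `V t`.

Measurability and identification of laws rest on Rényi's theorem: void events form a generating
`π`-system, and the void probability of a thinning is `(1 - p) ^ ξ(D)`. Continuity in `t` uses a
coupling of all retention probabilities by uniform marks. -/

theorem Config.countable_carrier (ξ : Config X) : ξ.carrier.Countable := by
  rcases isEmpty_or_nonempty X with h | ⟨⟨x₀⟩⟩
  · exact Set.to_countable _
  · have : ξ.carrier = ⋃ n : ℕ, ξ.carrier ∩ Metric.ball x₀ n := by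
      rw [← inter_iUnion, Metric.iUnion_ball_nat, inter_univ]
    rw [this]
    exact countable_iUnion fun n => (ξ.finite_inter _ Metric.isBounded_ball).countable

instance (ξ : Config X) : Countable ξ.carrier := ξ.countable_carrier

/-- The points of a configuration in a bounded set. -/
noncomputable def Config.points (ξ : Config X) {D : Set X} (hD : Bornology.IsBounded D) :
    Finset X := (ξ.finite_inter D hD).toFinset

@[simp]
theorem Config.mem_points (ξ : Config X) {D : Set X} (hD : Bornology.IsBounded D) {x : X} :
    x ∈ ξ.points hD ↔ x ∈ ξ.carrier ∧ x ∈ D := by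
  simp [Config.points]

/-- The event that a configuration has no point in `D`. -/
def voidEvent (D : Set X) : Set (Config X) := {ξ | Disjoint ξ.carrier D}

variable (X) in
/-- The void events of bounded measurable sets. -/
def voidEvents [MeasurableSpace X] : Set (Set (Config X)) :=
  {K | ∃ D : Set X, MeasurableSet D ∧ Bornology.IsBounded D ∧ K = voidEvent D}

theorem isPiSystem_voidEvents [MeasurableSpace X] : IsPiSystem (voidEvents X) := by
  rintro _ ⟨D, hD, hDb, rfl⟩ _ ⟨D', hD', hDb', rfl⟩ -
  refine ⟨D ∪ D', hD.union hD', hDb.union hDb', ?_⟩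
  ext ξ
  simp [voidEvent, disjoint_union_right]

/-- Finitely many points can be separated by disjoint sets of a countable basis, so counts are
expressed through countably many void events. -/
theorem le_card_points_iff [SecondCountableTopology X] (ξ : Config X) {D : Set X}
    (hb : Bornology.IsBounded D) (k : ℕ) :
    k ≤ (ξ.points hb).card ↔ ∃ U : Fin k → TopologicalSpace.countableBasis X,
      Pairwise (fun i j => Disjoint (U i : Set X) (U j)) ∧
        ∀ i, ¬ Disjoint ξ.carrier (D ∩ U i) := by
  constructor
  · intro h
    obtain ⟨t, ht, htk⟩ := Finset.exists_subset_card_eq h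
    obtain ⟨V, hV, hVd⟩ := t.finite_toSet.t2_separation
    let e := t.equivFinOfCardEq htk
    have key : ∀ x : X, ∃ U : TopologicalSpace.countableBasis X, x ∈ U.1 ∧ U.1 ⊆ V x := by
      intro x
      obtain ⟨U, hU, hxU, hUV⟩ := (TopologicalSpace.isBasis_countableBasis X).exists_subset_of_mem_open
        (hV x).1 (hV x).2
      exact ⟨⟨U, hU⟩, hxU, hUV⟩
    choose U hU hUV using key
    refine ⟨fun i => U (e.symm i), fun i j hij => ?_, fun i => ?_⟩
    · refine (hVd (e.symm i).2 (e.symm j).2 fun h => hij ?_).mono (hUV _) (hUV _)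
      exact e.symm.injective (Subtype.ext h)
    · have := ht (e.symm i).2
      rw [Config.mem_points] at this
      exact not_disjoint_iff.2 ⟨e.symm i, this.1, this.2, hU _⟩
  · rintro ⟨U, hU, hξ⟩
    simp_rw [not_disjoint_iff] at hξ
    choose x hx hxD using hξ
    have hinj : Function.Injective x := fun i j hij => by
      by_contra hne
      exact disjoint_left.1 (hU hne) (hxD i).2 (hij ▸ (hxD j).2)
    have := Finset.card_le_card_of_injOn (s := Finset.univ) (t := ξ.points hb) x
      (fun i _ => by simpa using ⟨hx i, (hxD i).1⟩) hinj.injOn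
    simpa using this

variable [MeasurableSpace X]

theorem Config.lintegral_toMeasure [MeasurableSingletonClass X] (ξ : Config X) (f : X → ℝ≥0∞) :
    ∫⁻ x, f x ∂ξ.toMeasure = ∑' x : ξ.carrier, f x := by
  simp [Config.toMeasure, lintegral_sum_measure]

theorem Config.toMeasure_apply (ξ : Config X) {D : Set X} (hD : MeasurableSet D) :
    ξ.toMeasure D = ((ξ.carrier ∩ D).encard : ℝ≥0∞) := by
  rw [Config.toMeasure, Measure.sum_apply _ hD, ← ENNReal.tsum_set_one,
    tsum_subtype (ξ.carrier) (fun x => Measure.dirac x D),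
    tsum_subtype (ξ.carrier ∩ D) (fun _ => (1 : ℝ≥0∞))]
  congr with x
  by_cases h : x ∈ ξ.carrier <;> by_cases h' : x ∈ D <;> simp [h, h', hD]

theorem Config.toMeasure_eq_zero_iff (ξ : Config X) {D : Set X} (hD : MeasurableSet D) :
    ξ.toMeasure D = 0 ↔ Disjoint ξ.carrier D := by
  rw [ξ.toMeasure_apply hD, disjoint_iff_inter_eq_empty]
  simp

theorem Config.toMeasure_eq_card (ξ : Config X) {D : Set X} (hD : MeasurableSet D)
    (hb : Bornology.IsBounded D) : ξ.toMeasure D = ((ξ.points hb).card : ℝ≥0∞) := by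
  rw [ξ.toMeasure_apply hD, (ξ.finite_inter D hb).encard_eq_coe_toFinset_card]
  simp [Config.points]

theorem Config.toMeasure_lt_top [BorelSpace X] (ξ : Config X) {D : Set X}
    (hb : Bornology.IsBounded D) : ξ.toMeasure D < ⊤ := by
  refine (measure_mono subset_closure).trans_lt ?_
  rw [ξ.toMeasure_eq_card isClosed_closure.measurableSet hb.closure]
  exact ENNReal.natCast_lt_top _

theorem Config.toMeasure_restrict [MeasurableSingletonClass X] (ξ : Config X) {D : Set X}
    (hD : MeasurableSet D) (hb : Bornology.IsBounded D) :
    ξ.toMeasure.restrict D = ∑ x ∈ ξ.points hb, Measure.dirac x := by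
  ext A hA
  rw [Measure.restrict_apply hA, ξ.toMeasure_eq_card (hA.inter hD) (hb.subset inter_subset_right)]
  classical
  simp only [Measure.coe_finsetSum, Finset.sum_apply, Measure.dirac_apply' _ hA]
  rw [Finset.card_eq_sum_ones, Nat.cast_sum]
  simp only [indicator_apply, Pi.one_apply, ← Finset.sum_filter]
  rw [Nat.cast_one]
  refine Finset.sum_congr ?_ fun _ _ => rfl
  ext x
  simp
  tauto

theorem Config.setLIntegral_toMeasure [MeasurableSingletonClass X] (ξ : Config X) {D : Set X}
    (hD : MeasurableSet D) (hb : Bornology.IsBounded D) (f : X → ℝ≥0∞) :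
    ∫⁻ x in D, f x ∂ξ.toMeasure = ∑ x ∈ ξ.points hb, f x := by
  rw [ξ.toMeasure_restrict hD hb, lintegral_finsetSum_measure]
  simp

theorem Config.integral_toMeasure [MeasurableSingletonClass X] (ξ : Config X) {D : Set X}
    (hD : MeasurableSet D) (hb : Bornology.IsBounded D) {f : X → ℝ} (hf : ∀ x, x ∉ D → f x = 0) :
    ∫ x, f x ∂ξ.toMeasure = ∑ x ∈ ξ.points hb, f x := by
  rw [← setIntegral_eq_integral_of_forall_compl_eq_zero hf, ξ.toMeasure_restrict hD hb,
    integral_finsetSum_measure fun x _ => integrable_dirac (by simp)]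
  simp

theorem Config.integrable_toMeasure [MeasurableSingletonClass X] (ξ : Config X) {D : Set X}
    (hD : MeasurableSet D) (hb : Bornology.IsBounded D) {f : X → ℝ} (hf : ∀ x, x ∉ D → f x = 0) :
    Integrable f ξ.toMeasure := by
  rw [← integrableOn_iff_integrable_of_support_subset
    (s := D) (fun x hx => by_contra fun h => hx (hf x h)), IntegrableOn,
    ξ.toMeasure_restrict hD hb, integrable_finsetSum_measure]
  exact fun x _ => integrable_dirac (by simp)

theorem IsTestFunction.exists_measurableSet [BorelSpace X] {f : X → ℝ} (hf : IsTestFunction f) :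
    ∃ D : Set X, MeasurableSet D ∧ Bornology.IsBounded D ∧ ∀ x, x ∉ D → f x = 0 := by
  obtain ⟨D, hD, h⟩ := hf.2.2
  exact ⟨closure D, isClosed_closure.measurableSet, hD.closure,
    fun x hx => h x fun h' => hx (subset_closure h')⟩

theorem measurable_toMeasure : Measurable (Config.toMeasure : Config X → Measure X) :=
  comap_measurable _

theorem measurable_toMeasure_apply {D : Set X} (hD : MeasurableSet D) :
    Measurable fun ξ : Config X => ξ.toMeasure D :=
  (Measure.measurable_coe hD).comp measurable_toMeasure

theorem measurableSet_voidEvent {D : Set X} (hD : MeasurableSet D) :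
    MeasurableSet (voidEvent D) := by
  have : voidEvent D = (fun ξ : Config X => ξ.toMeasure D) ⁻¹' {0} := by
    ext ξ
    simp [voidEvent, ξ.toMeasure_eq_zero_iff hD]
  rw [this]
  exact measurable_toMeasure_apply hD (measurableSet_singleton 0)

theorem measurable_card_points {D : Set X} (hD : MeasurableSet D) (hb : Bornology.IsBounded D) :
    Measurable fun ξ : Config X => (ξ.points hb).card := by
  have : (fun ξ : Config X => (ξ.points hb).card) =
      fun ξ : Config X => ⌊(ξ.toMeasure D).toReal⌋₊ := by
    ext ξ
    simp [ξ.toMeasure_eq_card hD hb]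
  rw [this]
  exact Nat.measurable_floor.comp (measurable_toMeasure_apply hD).ennreal_toReal

variable [BorelSpace X]

/-- The `σ`-algebra `m` is arbitrary so that this can be used to bound the given one by a generated
one. An unbounded set is exhausted by its intersections with balls. -/
theorem measurable_toMeasure_of_isBounded {m : MeasurableSpace (Config X)}
    (h : ∀ D : Set X, MeasurableSet D → Bornology.IsBounded D →
      Measurable[m] fun ξ : Config X => ξ.toMeasure D) :
    Measurable[m] (Config.toMeasure : Config X → Measure X) := by
  refine @Measure.measurable_of_measurable_coe _ _ _ m _ fun D hD => ?_
  rcases isEmpty_or_nonempty X with hX | ⟨⟨x₀⟩⟩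
  · exact h D hD (by simp [Set.eq_empty_of_isEmpty D])
  · have : ∀ ξ : Config X, ξ.toMeasure D = ⨆ n : ℕ, ξ.toMeasure (D ∩ Metric.ball x₀ n) := by
      intro ξ
      rw [← Monotone.measure_iUnion, ← inter_iUnion, Metric.iUnion_ball_nat, inter_univ]
      exact fun m n hmn => inter_subset_inter_right _ (Metric.ball_subset_ball (by exact_mod_cast hmn))
    simp_rw [this]
    exact Measurable.iSup fun n =>
      h _ (hD.inter measurableSet_ball) (Metric.isBounded_ball.subset inter_subset_right)

variable [SecondCountableTopology X]

/-- By `le_card_points_iff`, the event of at least `k` points in `D` is a countable union of finite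
intersections of complements of void events. -/
theorem generateFrom_voidEvents :
    (instMeasurableSpaceConfig : MeasurableSpace (Config X)) =
      MeasurableSpace.generateFrom (voidEvents X) := by
  refine le_antisymm ?_ (MeasurableSpace.generateFrom_le ?_)
  · refine measurable_iff_comap_le.1 ?_
    refine measurable_toMeasure_of_isBounded ?_
    intro D hD hb
    have hN : Measurable[MeasurableSpace.generateFrom (voidEvents X)]
        fun ξ : Config X => (ξ.points hb).card := by
      refine measurable_of_Ici fun k => ?_
      have : (fun ξ : Config X => (ξ.points hb).card) ⁻¹' Ici k =
          ⋃ U : Fin k → TopologicalSpace.countableBasis X,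
            ⋃ _ : Pairwise fun i j => Disjoint (U i : Set X) (U j),
              ⋂ i, (voidEvent (D ∩ U i))ᶜ := by
        ext ξ
        simp only [mem_preimage, mem_Ici, le_card_points_iff, mem_iUnion, mem_iInter,
          mem_compl_iff, voidEvent, mem_ofPred_eq, exists_prop]
      rw [this]
      have : Countable (TopologicalSpace.countableBasis X) :=
        TopologicalSpace.countable_countableBasis X
      refine MeasurableSet.iUnion fun U => MeasurableSet.iUnion fun _ =>
        MeasurableSet.iInter fun i => MeasurableSet.compl
          (MeasurableSpace.measurableSet_generateFrom ⟨_, ?_, hb.subset inter_subset_left, rfl⟩)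
      exact hD.inter (TopologicalSpace.isOpen_of_mem_countableBasis (U i).2).measurableSet
    simp_rw [fun ξ : Config X => ξ.toMeasure_eq_card hD hb]
    exact measurable_from_top.comp hN
  · rintro _ ⟨D, hD, -, rfl⟩
    exact measurableSet_voidEvent hD

theorem measurable_of_voidEvents {Ω : Type*} [MeasurableSpace Ω] {g : Ω → Config X}
    (h : ∀ D : Set X, MeasurableSet D → Bornology.IsBounded D → MeasurableSet (g ⁻¹' voidEvent D)) :
    Measurable g := by
  rw [generateFrom_voidEvents]
  refine measurable_generateFrom ?_
  rintro _ ⟨D, hD, hb, rfl⟩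
  exact h D hD hb

/-- Rényi's theorem: void events generate and are stable under intersection, since avoiding `D` and
`D'` is avoiding `D ∪ D'`. -/
theorem ext_of_voidEvents {μ ν : Measure (Config X)} [IsProbabilityMeasure μ]
    [IsProbabilityMeasure ν] (h : ∀ D : Set X, MeasurableSet D → Bornology.IsBounded D →
      μ (voidEvent D) = ν (voidEvent D)) : μ = ν := by
  refine ext_of_generate_finite _ generateFrom_voidEvents isPiSystem_voidEvents ?_ (by simp)
  rintro _ ⟨D, hD, hb, rfl⟩
  exact h D hD hb

end Counting

/-! ### S-finiteness of kernels without uniform bounds -/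

section KernelFacts

/-- Split the source according to the integer part of the total mass; on the `k`-th piece the mass
is less than `k + 1`. -/
theorem isSFiniteKernel_of_forall_lt_top {α β : Type*} [MeasurableSpace α] [MeasurableSpace β]
    (κ : Kernel α β) (h : ∀ a, κ a univ < ⊤) : IsSFiniteKernel κ := by
  classical
  let N : α → ℕ := fun a => ⌊(κ a univ).toReal⌋₊
  have hN : Measurable N :=
    Nat.measurable_floor.comp (κ.measurable_coe MeasurableSet.univ).ennreal_toReal
  have hs : ∀ k : ℕ, MeasurableSet (N ⁻¹' {k}) := fun k => hN (measurableSet_singleton k)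
  have hsum : κ = Kernel.sum fun k : ℕ => Kernel.piecewise (hs k) κ 0 := by
    ext a s hms
    rw [Kernel.sum_apply' _ _ hms, tsum_eq_single (N a)]
    · simp [Kernel.piecewise_apply]
    · intro k hk
      simp [Kernel.piecewise_apply, hk.symm]
  rw [hsum]
  have : ∀ k : ℕ, IsFiniteKernel (Kernel.piecewise (hs k) κ 0) := fun k => by
    refine ⟨(k + 1 : ℕ), ENNReal.natCast_lt_top _, fun a => ?_⟩
    rw [Kernel.piecewise_apply]
    split_ifs with ha
    · have h1 : (κ a univ).toReal < k + 1 := by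
        have := Nat.lt_floor_add_one (κ a univ).toReal
        rwa [show ⌊(κ a univ).toReal⌋₊ = k from ha] at this
      rw [← ENNReal.ofReal_toReal (h a).ne, ← ENNReal.ofReal_natCast]
      exact ENNReal.ofReal_le_ofReal (by push_cast; exact h1.le)
    · simp
  infer_instance

end KernelFacts

/-! ### The counting kernel -/

section Kernels

variable (X : Type*) [MetricSpace X] [MeasurableSpace X]

/-- The kernel sending a configuration to its counting measure. -/
noncomputable def countingKernel : Kernel (Config X) X := ⟨Config.toMeasure, measurable_toMeasure⟩

variable {X}

theorem countingKernel_apply (ξ : Config X) : countingKernel X ξ = ξ.toMeasure := rfl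

variable [BorelSpace X]

instance : IsSFiniteKernel (countingKernel X) := by
  rcases isEmpty_or_nonempty X with h | ⟨⟨x₀⟩⟩
  · exact isSFiniteKernel_of_forall_lt_top _ fun ξ => by
      rw [Set.eq_empty_of_isEmpty (univ : Set X)]; simp
  · let A : ℕ → Set X := disjointed fun n => Metric.ball x₀ n
    have hA : ∀ n, MeasurableSet (A n) := fun n =>
      MeasurableSet.disjointed (fun n => measurableSet_ball) n
    have hsum : countingKernel X = Kernel.sum fun n => (countingKernel X).restrict (hA n) := by
      ext ξ s hs
      rw [Kernel.sum_apply' _ _ hs]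
      simp_rw [Kernel.restrict_apply' _ (hA _) _ hs]
      rw [← measure_iUnion (fun i j hij => ((disjoint_disjointed _ hij).mono
        inter_subset_right inter_subset_right)) fun n => hs.inter (hA n), ← inter_iUnion,
        iUnion_disjointed, Metric.iUnion_ball_nat, inter_univ]
    rw [hsum]
    refine Kernel.isSFiniteKernel_sum (hκs := fun n => isSFiniteKernel_of_forall_lt_top _ fun ξ => ?_)
    rw [Kernel.restrict_apply' _ _ _ MeasurableSet.univ, univ_inter, countingKernel_apply]
    exact ξ.toMeasure_lt_top (Metric.isBounded_ball.subset (disjointed_subset _ n))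

instance (ξ : Config X) : SFinite ξ.toMeasure :=
  IsSFiniteKernel.sFinite (κ := countingKernel X) ξ

variable [SecondCountableTopology X]

/-- Needed for Radon-Nikodym derivatives of kernels. The counts on the members of a countable
generating algebra, cut by balls of integer radius, determine all others by a `π`-`λ` argument for
the finite restrictions to balls. -/
instance : MeasurableSpace.CountablyGenerated (Config X) := by
  rcases isEmpty_or_nonempty X with h | ⟨⟨x₀⟩⟩
  · have : Subsingleton (Config X) := ⟨fun ξ ζ => by ext x; exact isEmptyElim x⟩
    infer_instance
  · obtain ⟨b, hbc, hb⟩ := MeasurableSpace.CountablyGenerated.isCountablyGenerated (α := X)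
    let C := generateSetAlgebra b
    have hC : C.Countable := countable_generateSetAlgebra hbc
    have hgen : ‹MeasurableSpace X› = MeasurableSpace.generateFrom C := by
      rw [generateFrom_generateSetAlgebra_eq]; exact hb
    have hCm : ∀ s ∈ C, MeasurableSet s := fun s hs => by
      rw [hgen]; exact MeasurableSpace.measurableSet_generateFrom hs
    have : Countable C := hC
    let e : Config X → (C × ℕ → ℝ≥0∞) := fun ξ i => ξ.toMeasure (i.1 ∩ Metric.ball x₀ i.2)
    suffices h : (instMeasurableSpaceConfig : MeasurableSpace (Config X)) =
        MeasurableSpace.comap e inferInstance by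
      rw [h]; exact MeasurableSpace.CountablyGenerated.comap e
    refine le_antisymm (measurable_iff_comap_le.1 ?_) (measurable_iff_comap_le.1 ?_)
    · have he : Measurable[MeasurableSpace.comap e inferInstance] e := comap_measurable e
      have key : ∀ n : ℕ, Measurable[MeasurableSpace.comap e inferInstance]
          fun ξ : Config X => ξ.toMeasure.restrict (Metric.ball x₀ n) := by
        intro n
        have (ξ : Config X) : IsFiniteMeasure (ξ.toMeasure.restrict (Metric.ball x₀ n)) :=
          ⟨by simpa using ξ.toMeasure_lt_top Metric.isBounded_ball⟩
        refine @Measurable.measure_of_isPiSystem _ _ (MeasurableSpace.comap e inferInstance) _ _ _ C hgen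
          isSetAlgebra_generateSetAlgebra.isSetRing.isSetSemiring.isPiSystem ?_ ?_
        · intro s hs
          simp_rw [Measure.restrict_apply (hCm s hs)]
          exact (measurable_pi_apply ((⟨s, hs⟩, n) : C × ℕ)).comp he
        · simp_rw [Measure.restrict_apply MeasurableSet.univ]
          exact (measurable_pi_apply ((⟨univ, isSetAlgebra_generateSetAlgebra.univ_mem⟩, n) : C × ℕ)).comp he
      refine measurable_toMeasure_of_isBounded fun D hD hDb => ?_
      obtain ⟨n, hn⟩ := hDb.subset_ball x₀
      obtain ⟨k, hk⟩ := exists_nat_ge n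
      have : (fun ξ : Config X => ξ.toMeasure D) =
          fun ξ => (ξ.toMeasure.restrict (Metric.ball x₀ k)) D := by
        ext ξ
        rw [Measure.restrict_apply hD, inter_eq_left.2 (hn.trans (Metric.ball_subset_ball hk))]
      rw [this]
      exact (Measure.measurable_coe hD).comp (key k)
    · exact measurable_pi_lambda _ fun i =>
        measurable_toMeasure_apply ((hCm _ i.1.2).inter measurableSet_ball)

end Kernels

/-! ### Superposition of independent thinnings -/

section Superposition

variable {X : Type*} [MetricSpace X]

/-- The configuration of all points of `ξ` and `ζ`. -/
def Config.union (ξ ζ : Config X) : Config X where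
  carrier := ξ.carrier ∪ ζ.carrier
  finite_inter D hD := by
    rw [union_inter_distrib_right]
    exact (ξ.finite_inter D hD).union (ζ.finite_inter D hD)

/-- The thinning of `ξ` in which the points with mark below `p` are kept. -/
def Config.retain (ξ : Config X) (p : I) (ω : ξ.carrier → I) : Config X :=
  ξ.restrict (Subtype.val '' {x | ω x < p})

theorem Config.mem_retain (ξ : Config X) (p : I) (ω : ξ.carrier → I) (x : ξ.carrier) :
    (x : X) ∈ (ξ.retain p ω).carrier ↔ ω x < p := by
  simp [Config.retain, Config.restrict]

theorem Config.retain_subset (ξ : Config X) (p : I) (ω : ξ.carrier → I) :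
    (ξ.retain p ω).carrier ⊆ ξ.carrier := inter_subset_left

/-- Thinnings of `ξ` and `ζ` with these retention probabilities never have a common point. -/
def Compatible (p q : I) (ξ ζ : Config X) : Prop :=
  Disjoint ξ.carrier ζ.carrier ∨ p = 0 ∨ q = 0

theorem Compatible.symm {p q : I} {ξ ζ : Config X} (h : Compatible p q ξ ζ) :
    Compatible q p ζ ξ := by
  rcases h with h | h | h
  · exact Or.inl h.symm
  · exact Or.inr (Or.inr h)
  · exact Or.inr (Or.inl h)

theorem Compatible.mono_right {p q : I} {ξ ζ ζ' : Config X} (h : Compatible p q ξ ζ)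
    (h' : ζ'.carrier ⊆ ζ.carrier) : Compatible p q ξ ζ' :=
  h.imp_left fun h => h.mono_right h'

theorem Compatible.disjoint_retain {p q : I} {ξ ζ : Config X} (h : Compatible p q ξ ζ)
    (ω : ξ.carrier → I) (ω' : ζ.carrier → I) :
    Disjoint (ξ.retain p ω).carrier (ζ.retain q ω').carrier := by
  rcases h with h | rfl | rfl
  · exact h.mono (ξ.retain_subset p ω) (ζ.retain_subset q ω')
  · have : (ξ.retain 0 ω).carrier = ∅ := by
      ext x
      simp only [mem_empty_iff_false, iff_false]
      -- Retention is by a strict inequality, so retention probability `0` keeps nothing for every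
      -- choice of marks, not only almost surely.
      exact fun hx => not_lt.2 (unitInterval.nonneg' (t := ω ⟨x, ξ.retain_subset 0 ω hx⟩))
        ((ξ.mem_retain 0 ω ⟨x, ξ.retain_subset 0 ω hx⟩).1 hx)
    simp [this]
  · have : (ζ.retain 0 ω').carrier = ∅ := by
      ext x
      simp only [mem_empty_iff_false, iff_false]
      exact fun hx => not_lt.2 (unitInterval.nonneg' (t := ω' ⟨x, ζ.retain_subset 0 ω' hx⟩))
        ((ζ.mem_retain 0 ω' ⟨x, ζ.retain_subset 0 ω' hx⟩).1 hx)
    simp [this]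

/-- Independent uniform marks of the points of a configuration. -/
noncomputable def markLaw (ξ : Config X) : Measure (ξ.carrier → I) :=
  Measure.infinitePi fun _ => volume

instance (ξ : Config X) : IsProbabilityMeasure (markLaw ξ) := by
  unfold markLaw; infer_instance

/-- The points of a configuration in a bounded set, as a set of indices of marks. -/
noncomputable def Config.indices (ξ : Config X) {D : Set X} (hb : Bornology.IsBounded D) :
    Finset ξ.carrier :=
  (ξ.finite_inter D hb).preimage Subtype.val_injective.injOn |>.toFinset

theorem Config.mem_indices (ξ : Config X) {D : Set X} (hb : Bornology.IsBounded D)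
    (x : ξ.carrier) : x ∈ ξ.indices hb ↔ (x : X) ∈ D := by
  simp [Config.indices]

theorem Config.map_indices (ξ : Config X) {D : Set X} (hb : Bornology.IsBounded D) :
    (ξ.indices hb).map (Function.Embedding.subtype _) = ξ.points hb := by
  ext x
  simp [Config.mem_indices, and_comm]

theorem Config.map_indices_retain (ξ : Config X) {D : Set X} (hb : Bornology.IsBounded D) (p : I)
    (ω : ξ.carrier → I) :
    ((ξ.indices hb).filter fun x => ω x < p).map (Function.Embedding.subtype _) =
      (ξ.retain p ω).points hb := by
  ext x
  simp only [Finset.mem_map, Finset.mem_filter, Config.mem_indices, Config.mem_points,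
    Function.Embedding.subtype_apply, Subtype.exists, exists_and_right, exists_eq_right]
  constructor
  · rintro ⟨hx, hD, hω⟩
    exact ⟨(ξ.mem_retain p ω ⟨x, hx⟩).2 hω, hD⟩
  · rintro ⟨hx, hD⟩
    have h := ξ.retain_subset p ω hx
    exact ⟨h, hD, (ξ.mem_retain p ω ⟨x, h⟩).1 hx⟩

variable [MeasurableSpace X]

theorem Config.toMeasure_union [MeasurableSingletonClass X] {ξ ζ : Config X}
    (h : Disjoint ξ.carrier ζ.carrier) :
    (ξ.union ζ).toMeasure = ξ.toMeasure + ζ.toMeasure := by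
  ext D hD
  rw [Measure.add_apply, Config.toMeasure_apply _ hD, Config.toMeasure_apply _ hD,
    Config.toMeasure_apply _ hD]
  have : (ξ.union ζ).carrier ∩ D = (ξ.carrier ∩ D) ∪ (ζ.carrier ∩ D) :=
    union_inter_distrib_right _ _ _
  rw [this, encard_union_eq (h.mono inter_subset_left inter_subset_left)]
  push_cast
  rfl

theorem Config.toMeasure_union_le [MeasurableSingletonClass X] (ξ ζ : Config X) {D : Set X}
    (hD : MeasurableSet D) :
    (ξ.union ζ).toMeasure D ≤ ξ.toMeasure D + ζ.toMeasure D := by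
  rw [Config.toMeasure_apply _ hD, Config.toMeasure_apply _ hD,
    Config.toMeasure_apply _ hD]
  have : (ξ.union ζ).carrier ∩ D = (ξ.carrier ∩ D) ∪ (ζ.carrier ∩ D) :=
    union_inter_distrib_right _ _ _
  rw [this]
  exact_mod_cast encard_union_le _ _

theorem Config.toMeasure_mono {ξ ζ : Config X} (h : ξ.carrier ⊆ ζ.carrier) {D : Set X}
    (hD : MeasurableSet D) : ξ.toMeasure D ≤ ζ.toMeasure D := by
  rw [Config.toMeasure_apply _ hD, Config.toMeasure_apply _ hD]
  exact_mod_cast encard_le_encard (inter_subset_inter_left D h)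

theorem measurable_toMeasure_add :
    Measurable fun a : Config X × Config X => a.1.toMeasure + a.2.toMeasure := by
  refine Measure.measurable_of_measurable_coe _ fun D hD => ?_
  simp_rw [Measure.add_apply]
  exact ((measurable_toMeasure_apply hD).comp measurable_fst).add
    ((measurable_toMeasure_apply hD).comp measurable_snd)

variable [BorelSpace X] [SecondCountableTopology X]

theorem measurable_union : Measurable fun a : Config X × Config X => a.1.union a.2 := by
  refine measurable_of_voidEvents fun D hD _ => ?_
  have : (fun a : Config X × Config X => a.1.union a.2) ⁻¹' voidEvent D =
      voidEvent D ×ˢ voidEvent D := by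
    ext a
    simp [voidEvent, Config.union, disjoint_union_left]
  rw [this]
  exact (measurableSet_voidEvent hD).prod (measurableSet_voidEvent hD)

theorem measurable_restrict_image (ξ : Config X) :
    Measurable fun s : Set ξ.carrier => ξ.restrict (Subtype.val '' s) := by
  refine measurable_of_voidEvents fun D hD _ => ?_
  have : (fun s : Set ξ.carrier => ξ.restrict (Subtype.val '' s)) ⁻¹' voidEvent D =
      ⋂ x : ξ.carrier, ⋂ _ : (x : X) ∈ D, {s | x ∉ s} := by
    ext s
    simp only [voidEvent, Config.restrict, mem_preimage, mem_ofPred_eq, disjoint_left, mem_iInter]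
    constructor
    · exact fun h x hx hs => h ⟨x.2, x, hs, rfl⟩ hx
    · rintro h _ ⟨-, x, hs, rfl⟩ hx
      exact h x hx hs
  rw [this]
  exact MeasurableSet.iInter fun x => MeasurableSet.iInter fun _ =>
    measurableSet_setOfPred.2 (measurable_set_notMem x)

theorem measurable_retain (ξ : Config X) (p : I) : Measurable (ξ.retain p) :=
  (measurable_restrict_image ξ).comp <| measurable_set_iff.2 fun x => measurableSet_setOfPred.1
    (measurableSet_lt (measurable_pi_apply x) measurable_const)

/-- A uniform mark is below `p` with probability `p`. This realizes the thinnings for all `p` on one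
probability space, which the continuity proof needs. -/
theorem thinning_eq_map (p : I) (ξ : Config X) : thinning p ξ = (markLaw ξ).map (ξ.retain p) := by
  have hI : MeasurableSet {u : I | u < p} := measurableSet_Iio
  have hm : Measurable fun u : I => u < p := measurableSet_setOfPred.1 hI
  have hp : (volume : Measure I).map (fun u => u < p) = unitInterval.toNNReal p •
      Measure.dirac True + unitInterval.toNNReal (σ p) • Measure.dirac False := by
    ext s hs
    rw [Measure.map_apply hm hs]
    have h1 : volume {u : I | u < p} = unitInterval.toNNReal p := by
      rw [show {u : I | u < p} = Iio p from rfl, unitInterval.volume_Iio]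
      exact ENNReal.ofReal_eq_coe_nnreal p.2.1
    have h2 : volume {u : I | ¬ u < p} = unitInterval.toNNReal (σ p) := by
      rw [show {u : I | ¬ u < p} = Ici p from by ext; simp, unitInterval.volume_Ici]
      exact ENNReal.ofReal_eq_coe_nnreal (σ p).2.1
    -- A set of propositions is determined by whether it contains `True` and `False`.
    by_cases hT : True ∈ s <;> by_cases hF : False ∈ s
    · have : (fun u : I => u < p) ⁻¹' s = univ := by
        ext u; by_cases h : u < p <;> simp [-not_lt, h, hT, hF]
      rw [this]
      simp [hT, hF, Measure.add_apply, ← ENNReal.coe_add]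
    · have : (fun u : I => u < p) ⁻¹' s = {u | u < p} := by
        ext u; by_cases h : u < p <;> simp [-not_lt, h, hT, hF]
      rw [this, h1]
      simp [hT, hF, Measure.add_apply]
    · have : (fun u : I => u < p) ⁻¹' s = {u | ¬ u < p} := by
        ext u; by_cases h : u < p <;> simp [-not_lt, h, hT, hF]
      rw [this, h2]
      simp [hT, hF, Measure.add_apply]
    · have : (fun u : I => u < p) ⁻¹' s = ∅ := by
        ext u; by_cases h : u < p <;> simp [-not_lt, h, hT, hF]
      rw [this]
      simp [hT, hF, Measure.add_apply]
  rw [thinning, setBernoulli_eq_map]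
  simp only [mem_univ]
  simp_rw [← hp]
  rw [← Measure.infinitePi_map_pi (fun _ : ξ.carrier => (volume : Measure I)) (fun _ => hm),
    Measure.map_map, Measure.map_map]
  · rfl
  · refine (measurable_restrict_image ξ).comp ?_
    exact measurable_set_iff.2 fun x => measurable_pi_apply x
  · exact measurable_pi_lambda _ fun x => hm.comp (measurable_pi_apply x)
  · exact measurable_restrict_image ξ
  · exact measurable_set_iff.2 fun x => measurable_pi_apply x

instance (p : I) (ξ : Config X) : IsProbabilityMeasure (thinning p ξ) := by
  rw [thinning_eq_map]
  exact Measure.isProbabilityMeasure_map (measurable_retain ξ p).aemeasurable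

/-- The thinning avoids `D` exactly when the independent marks of the finitely many points in `D`
are all at least `p`. -/
theorem thinning_voidEvent (p : I) (ξ : Config X) {D : Set X} (hD : MeasurableSet D)
    (hb : Bornology.IsBounded D) :
    thinning p ξ (voidEvent D) = ENNReal.ofReal (1 - p) ^ (ξ.points hb).card := by
  rw [thinning_eq_map, Measure.map_apply (measurable_retain ξ p) (measurableSet_voidEvent hD)]
  have : ξ.retain p ⁻¹' voidEvent D = Set.pi (ξ.indices hb) fun _ => Ici p := by
    ext ω
    simp only [voidEvent, mem_preimage, mem_ofPred_eq, disjoint_left, Set.mem_pi, Finset.mem_coe,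
      Config.mem_indices, mem_Ici]
    constructor
    · exact fun h x hx => not_lt.1 fun h' => h ((ξ.mem_retain p ω x).2 h') hx
    · exact fun h x hx hxD => not_lt.2 (h ⟨x, ξ.retain_subset p ω hx⟩ hxD)
        ((ξ.mem_retain p ω ⟨x, ξ.retain_subset p ω hx⟩).1 hx)
  rw [this, markLaw, Measure.infinitePi_pi _ fun _ _ => measurableSet_Ici]
  simp [← ξ.map_indices hb]

/-- The law of the superposition of independent thinnings of `ξ` and `ζ`. -/
noncomputable def thinUnion (p q : I) (ξ ζ : Config X) : Measure (Config X) :=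
  ((thinning p ξ).prod (thinning q ζ)).map fun a => a.1.union a.2

instance (p q : I) (ξ ζ : Config X) : IsProbabilityMeasure (thinUnion p q ξ ζ) :=
  Measure.isProbabilityMeasure_map measurable_union.aemeasurable

theorem thinUnion_voidEvent (p q : I) (ξ ζ : Config X) {D : Set X} (hD : MeasurableSet D)
    (hb : Bornology.IsBounded D) :
    thinUnion p q ξ ζ (voidEvent D) = ENNReal.ofReal (1 - p) ^ (ξ.points hb).card *
      ENNReal.ofReal (1 - q) ^ (ζ.points hb).card := by
  rw [thinUnion, Measure.map_apply measurable_union (measurableSet_voidEvent hD)]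
  have : (fun a : Config X × Config X => a.1.union a.2) ⁻¹' voidEvent D =
      voidEvent D ×ˢ voidEvent D := by
    ext a
    simp [voidEvent, Config.union, disjoint_union_left]
  rw [this, Measure.prod_prod, thinning_voidEvent p ξ hD hb, thinning_voidEvent q ζ hD hb]

theorem thinUnion_eq_map (p q : I) (ξ ζ : Config X) :
    thinUnion p q ξ ζ = ((markLaw ξ).prod (markLaw ζ)).map
      fun ω => (ξ.retain p ω.1).union (ζ.retain q ω.2) := by
  rw [thinUnion, thinning_eq_map, thinning_eq_map,
    Measure.map_prod_map _ _ (measurable_retain ξ p) (measurable_retain ζ q),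
    Measure.map_map measurable_union ((measurable_retain ξ p).prodMap (measurable_retain ζ q))]
  rfl

theorem measurable_retain_union (p q : I) (ξ ζ : Config X) :
    Measurable fun ω : (ξ.carrier → I) × (ζ.carrier → I) =>
      (ξ.retain p ω.1).union (ζ.retain q ω.2) :=
  measurable_union.comp ((measurable_retain ξ p).prodMap (measurable_retain ζ q))

variable (X) in
/-- The superposition of independent thinnings as a probability kernel. -/
noncomputable def thinUnionKernel : Kernel ((I × I) × Config X × Config X) (Config X) where
  toFun a := thinUnion a.1.1 a.1.2 a.2.1 a.2.2
  measurable' := by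
    -- It suffices to test on void events, where the probability is an explicit function of the
    -- parameters and the counts.
    refine Measurable.measure_of_isPiSystem_of_isProbabilityMeasure generateFrom_voidEvents
      isPiSystem_voidEvents ?_
    rintro _ ⟨D, hD, hb, rfl⟩
    simp_rw [thinUnion_voidEvent _ _ _ _ hD hb]
    have h := measurable_card_points hD hb
    exact ((by fun_prop : Measurable fun a : (I × I) × Config X × Config X =>
      ENNReal.ofReal (1 - a.1.1)).pow (h.comp (by fun_prop))).mul
      ((by fun_prop : Measurable fun a : (I × I) × Config X × Config X =>
      ENNReal.ofReal (1 - a.1.2)).pow (h.comp (by fun_prop)))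

theorem thinUnionKernel_apply (a : (I × I) × Config X × Config X) :
    thinUnionKernel X a = thinUnion a.1.1 a.1.2 a.2.1 a.2.2 := rfl

instance : IsMarkovKernel (thinUnionKernel X) :=
  ⟨fun a => by rw [thinUnionKernel_apply]; infer_instance⟩

/-- The sum of counting measures keeps multiplicities while the union merges them; compatibility
makes the two agree for all marks. -/
theorem thinnedSum_eq_map {p q : I} {ξ ζ : Config X} (h : Compatible p q ξ ζ) :
    thinnedSum p q ξ ζ = (thinUnion p q ξ ζ).map Config.toMeasure := by
  rw [thinnedSum, thinUnion_eq_map, thinning_eq_map, thinning_eq_map,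
    Measure.map_prod_map _ _ (measurable_retain ξ p) (measurable_retain ζ q),
    Measure.map_map measurable_toMeasure_add
      ((measurable_retain ξ p).prodMap (measurable_retain ζ q)),
    Measure.map_map measurable_toMeasure (measurable_retain_union p q ξ ζ)]
  congr 1
  ext1 ω
  exact (Config.toMeasure_union (h.disjoint_retain ω.1 ω.2)).symm

theorem thinnedSum_comm (p q : I) (ξ ζ : Config X) : thinnedSum p q ξ ζ = thinnedSum q p ζ ξ := by
  rw [thinnedSum, thinnedSum, ← Measure.prod_swap,
    Measure.map_map measurable_toMeasure_add measurable_swap]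
  congr 1
  ext1 a
  exact add_comm _ _

end Superposition

/-! ### Vague continuity in the retention probabilities -/

section VagueContinuity

variable {X : Type*} [MetricSpace X] [MeasurableSpace X] [BorelSpace X]

/-- Test functions vanish outside bounded sets, so their integrals are eventually constant once the
points in each bounded set are. -/
theorem tendsto_config {T : Type*} {l : Filter T} {g : T → Config X} {ξ : Config X}
    (h : ∀ (D : Set X) (hb : Bornology.IsBounded D), ∀ᶠ t in l, (g t).points hb = ξ.points hb) :
    Tendsto g l (𝓝 ξ) := by
  rw [nhds_induced, tendsto_comap_iff, tendsto_pi_nhds]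
  intro f
  obtain ⟨D, hD, hb, hf⟩ := f.2.exists_measurableSet
  refine tendsto_const_nhds.congr' ((h D hb).mono fun t ht => ?_)
  simp only [Function.comp_apply]
  rw [Config.integral_toMeasure _ hD hb hf, Config.integral_toMeasure _ hD hb hf, ht]

theorem IsContinuousSublinear.exists_bound {F : Config X → ℝ} (hF : IsContinuousSublinear F) :
    ∃ K : ℝ, 0 ≤ K ∧ ∃ D : Set X, MeasurableSet D ∧ ∃ hb : Bornology.IsBounded D,
      ∀ η : Config X, |F η| ≤ K * (1 + (η.points hb).card) := by
  obtain ⟨c, hc, f, hf, hFf⟩ := hF.2.2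
  obtain ⟨D, hD, hb, hfD⟩ := hf.exists_measurableSet
  obtain ⟨C, hC⟩ := hf.2.1
  -- With `N` points in `D` and `f ≤ |C|`, one has `1 + ∫ f ≤ 1 + N |C| ≤ (1 + |C|) (1 + N)`.
  refine ⟨c * (1 + |C|), by positivity, D, hD, hb, fun η => (hFf η).trans ?_⟩
  rw [mul_assoc]
  refine mul_le_mul_of_nonneg_left ?_ hc.le
  rw [Config.integral_toMeasure _ hD hb hfD]
  have h1 : ∑ x ∈ η.points hb, f x ≤ (η.points hb).card * |C| := by
    rw [← nsmul_eq_mul]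
    exact Finset.sum_le_card_nsmul _ _ _ fun x _ =>
      (le_abs_self _).trans ((hC x).trans (le_abs_self C))
  have h2 : (0 : ℝ) ≤ (η.points hb).card := by positivity
  nlinarith [abs_nonneg C]

theorem Config.card_points_union_retain_le (ξ ζ : Config X) {D : Set X}
    (hb : Bornology.IsBounded D) (p q : I) (ω : ξ.carrier → I) (ω' : ζ.carrier → I) :
    (((ξ.retain p ω).union (ζ.retain q ω')).points hb).card ≤
      (ξ.points hb).card + (ζ.points hb).card := by
  classical
  refine (Finset.card_le_card ?_).trans (Finset.card_union_le _ _)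
  intro x hx
  rw [Config.mem_points] at hx
  rw [Finset.mem_union, Config.mem_points, Config.mem_points]
  rcases hx with ⟨hx | hx, hxD⟩
  · exact Or.inl ⟨ξ.retain_subset p ω hx, hxD⟩
  · exact Or.inr ⟨ζ.retain_subset q ω' hx, hxD⟩

theorem Config.integrable_card_points (P : Law X) {D : Set X} (hD : MeasurableSet D)
    (hb : Bornology.IsBounded D) :
    Integrable (fun ξ : Config X => ((ξ.points hb).card : ℝ)) P.measure := by
  refine ⟨(measurable_from_top.comp (measurable_card_points hD hb)).aestronglyMeasurable, ?_⟩
  rw [hasFiniteIntegral_iff_enorm]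
  convert P.locallyIntegrable D hD hb using 3 with ξ
  rw [ξ.toMeasure_eq_card hD hb]
  simp

/-- Only the finitely many marks in `D` matter, and comparing a mark different from `p₀` with `p`
gives a constant answer for `p` near `p₀`. -/
theorem tendsto_retain {T : Type*} {l : Filter T} {p : T → I} {p₀ : I} (hp : Tendsto p l (𝓝 p₀))
    (ξ : Config X) {ω : ξ.carrier → I} (hω : ∀ x, ω x ≠ p₀) {D : Set X}
    (hb : Bornology.IsBounded D) :
    ∀ᶠ t in l, (ξ.retain (p t) ω).points hb = (ξ.retain p₀ ω).points hb := by
  have : ∀ᶠ t in l, ∀ x ∈ ξ.indices hb, (ω x < p t ↔ ω x < p₀) := by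
    rw [Filter.eventually_all_finset]
    intro x _
    rcases lt_or_gt_of_ne (hω x) with h | h
    · filter_upwards [hp.eventually (lt_mem_nhds h)] with t ht
      simp [h, ht]
    · filter_upwards [hp.eventually (gt_mem_nhds h)] with t ht
      simp [h.not_gt, ht.not_gt]
  filter_upwards [this] with t ht
  rw [← Config.map_indices_retain, ← Config.map_indices_retain]
  congr 1
  exact Finset.filter_congr ht

theorem ae_markLaw_ne (ξ : Config X) (p : I) : ∀ᵐ ω ∂markLaw ξ, ∀ x, ω x ≠ p := by
  rw [ae_all_iff]
  intro x
  have h := (measurePreserving_eval_infinitePi (fun _ : ξ.carrier => (volume : Measure I)) x)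
  have h0 : ∀ᵐ u ∂(volume : Measure I), u ≠ p := by
    simp [ae_iff]
  exact h.quasiMeasurePreserving.ae h0

variable [SecondCountableTopology X]

theorem lintegral_thinUnion_le (p q : I) (ξ ζ : Config X) {D : Set X} (hD : MeasurableSet D) :
    ∫⁻ η, η.toMeasure D ∂thinUnion p q ξ ζ ≤ ξ.toMeasure D + ζ.toMeasure D := by
  have h1 := measurable_toMeasure_apply (X := X) hD
  have h2 := measurable_retain_union p q ξ ζ
  rw [thinUnion_eq_map]
  have := lintegral_map (μ := (markLaw ξ).prod (markLaw ζ)) h1 h2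
  rw [this]
  have h3 : ∀ ω : (ξ.carrier → I) × (ζ.carrier → I),
    ((ξ.retain p ω.1).union (ζ.retain q ω.2)).toMeasure D ≤ ξ.toMeasure D + ζ.toMeasure D := fun ω =>
    (Config.toMeasure_union_le _ _ hD).trans (add_le_add
    (Config.toMeasure_mono (ξ.retain_subset p ω.1) hD)
    (Config.toMeasure_mono (ζ.retain_subset q ω.2) hD))
  refine (lintegral_mono h3).trans ?_
  rw [lintegral_const, measure_univ, mul_one]

/-- With the marks fixed, the superpositions converge vaguely for almost all marks, since no mark
equals `p₀` or `q₀`. The number of points in `D` before thinning gives the dominating constant. -/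
theorem tendsto_integral_thinUnion {T : Type*} {l : Filter T} [l.IsCountablyGenerated]
    {p q : T → I} {p₀ q₀ : I} (hp : Tendsto p l (𝓝 p₀)) (hq : Tendsto q l (𝓝 q₀))
    {F : Config X → ℝ} (hF : IsContinuousSublinear F) (ξ ζ : Config X) :
    Tendsto (fun t => ∫ η, F η ∂thinUnion (p t) (q t) ξ ζ) l
      (𝓝 (∫ η, F η ∂thinUnion p₀ q₀ ξ ζ)) := by
  obtain ⟨K, hK, D, hD, hb, hKF⟩ := hF.exists_bound
  have hmap : ∀ p q : I, ∫ η, F η ∂thinUnion p q ξ ζ =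
      ∫ ω, F ((ξ.retain p ω.1).union (ζ.retain q ω.2)) ∂(markLaw ξ).prod (markLaw ζ) := by
    intro p q
    rw [thinUnion_eq_map, integral_map (measurable_retain_union p q ξ ζ).aemeasurable
      hF.1.aestronglyMeasurable]
  simp_rw [hmap]
  refine tendsto_integral_filter_of_dominated_convergence
    (fun _ => K * (1 + ((ξ.points hb).card + (ζ.points hb).card : ℕ))) ?_ ?_
    (integrable_const _) ?_
  · exact Eventually.of_forall fun t =>
      (hF.1.comp (measurable_retain_union _ _ ξ ζ)).aestronglyMeasurable
  · refine Eventually.of_forall fun t => Eventually.of_forall fun ω => (hKF _).trans ?_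
    refine mul_le_mul_of_nonneg_left ?_ hK
    have := Config.card_points_union_retain_le ξ ζ hb (p t) (q t) ω.1 ω.2
    gcongr
  · have h1 := Measure.quasiMeasurePreserving_fst (μ := markLaw ξ) (ν := markLaw ζ)
      |>.ae (ae_markLaw_ne ξ p₀)
    have h2 := Measure.quasiMeasurePreserving_snd (μ := markLaw ξ) (ν := markLaw ζ)
      |>.ae (ae_markLaw_ne ζ q₀)
    filter_upwards [h1, h2] with ω hω hω'
    refine (hF.2.1.tendsto _).comp (tendsto_config fun D hb => ?_)
    filter_upwards [tendsto_retain hp ξ hω hb, tendsto_retain hq ζ hω' hb] with t ht ht'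
    ext x
    have h := Finset.ext_iff.1 ht x
    have h' := Finset.ext_iff.1 ht' x
    simp only [Config.mem_points] at h h' ⊢
    simp only [Config.union, mem_union, or_and_right, h, h']

end VagueContinuity

/-! ### Laws of superposed thinnings -/

section ThinLaw

variable {X : Type*} [MetricSpace X] [MeasurableSpace X] [BorelSpace X]
  [SecondCountableTopology X]

instance (P : Law X) : IsProbabilityMeasure P.measure := P.isProbabilityMeasure

variable (X) in
/-- The superposition of thinnings with fixed retention probabilities, as a probability kernel. -/
noncomputable def thinPairKernel (p q : I) : Kernel (Config X × Config X) (Config X) :=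
  (thinUnionKernel X).comap (fun a => ((p, q), a)) measurable_prodMk_left

theorem thinPairKernel_apply (p q : I) (a : Config X × Config X) :
    thinPairKernel X p q a = thinUnion p q a.1 a.2 := rfl

instance (p q : I) : IsMarkovKernel (thinPairKernel X p q) := by
  unfold thinPairKernel; infer_instance

/-- The law of the superposition of independent thinnings of independent configurations with laws
`P₀` and `P₁`. -/
noncomputable def thinLaw (P₀ P₁ : Law X) (p q : I) : Law X where
  measure := thinPairKernel X p q ∘ₘ (P₀.measure.prod P₁.measure)
  isProbabilityMeasure := inferInstance
  locallyIntegrable D hD hb := by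
    have h := measurable_toMeasure_apply (X := X) hD
    rw [Measure.lintegral_bind (Kernel.aemeasurable _) h.aemeasurable]
    have hle : ∀ a : Config X × Config X, ∫⁻ η, η.toMeasure D ∂thinPairKernel X p q a ≤
        a.1.toMeasure D + a.2.toMeasure D := fun a => lintegral_thinUnion_le p q a.1 a.2 hD
    refine (lintegral_mono hle).trans_lt ?_
    have h₀ : Measurable fun a : Config X × Config X => a.1.toMeasure D := h.comp measurable_fst
    have h₁ : Measurable fun a : Config X × Config X => a.2.toMeasure D := h.comp measurable_snd
    rw [lintegral_add_left h₀, lintegral_prod _ h₀.aemeasurable, lintegral_prod _ h₁.aemeasurable]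
    simpa using ⟨P₀.locallyIntegrable D hD hb, P₁.locallyIntegrable D hD hb⟩

theorem thinLaw_apply (P₀ P₁ : Law X) (p q : I) {K : Set (Config X)} (hK : MeasurableSet K) :
    (thinLaw P₀ P₁ p q).measure K =
      ∫⁻ ξ, ∫⁻ ζ, thinUnion p q ξ ζ K ∂P₁.measure ∂P₀.measure := by
  have h : (thinLaw P₀ P₁ p q).measure K =
      ∫⁻ a, thinPairKernel X p q a K ∂(P₀.measure.prod P₁.measure) :=
    Measure.bind_apply hK (Kernel.aemeasurable _)
  rw [h, lintegral_prod _ (Kernel.measurable_coe _ hK).aemeasurable]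
  rfl

theorem thinLaw_voidEvent (P₀ P₁ : Law X) (p q : I) {D : Set X} (hD : MeasurableSet D)
    (hb : Bornology.IsBounded D) :
    (thinLaw P₀ P₁ p q).measure (voidEvent D) =
      ∫⁻ ξ, ∫⁻ ζ, ENNReal.ofReal (1 - p) ^ (ξ.points hb).card *
        ENNReal.ofReal (1 - q) ^ (ζ.points hb).card ∂P₁.measure ∂P₀.measure := by
  simp_rw [thinLaw_apply _ _ _ _ (measurableSet_voidEvent hD), thinUnion_voidEvent _ _ _ _ hD hb]

theorem voidEvent_eq_points {D : Set X} (hb : Bornology.IsBounded D) :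
    voidEvent D = {ξ : Config X | (ξ.points hb).card = 0} := by
  ext ξ
  simp only [voidEvent, mem_ofPred_eq, Finset.card_eq_zero, disjoint_left,
    Finset.eq_empty_iff_forall_notMem, Config.mem_points, not_and]

/-- As `0 ^ 0 = 1`, the integrand is the indicator of the void event. -/
theorem lintegral_zero_pow_card (P : Law X) {D : Set X} (hD : MeasurableSet D)
    (hb : Bornology.IsBounded D) :
    ∫⁻ ξ, 0 ^ (ξ.points hb).card ∂P.measure = P.measure (voidEvent D) := by
  rw [← lintegral_indicator_one (measurableSet_voidEvent hD), voidEvent_eq_points hb]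
  refine lintegral_congr fun ξ => ?_
  simp only [indicator_apply, mem_ofPred_eq, Pi.one_apply, zero_pow_eq]

theorem thinLaw_one_zero (P₀ P₁ : Law X) : thinLaw P₀ P₁ 1 0 = P₀ := by
  refine Law.ext (ext_of_voidEvents fun D hD hb => ?_)
  rw [thinLaw_voidEvent _ _ _ _ hD hb]
  simp [lintegral_zero_pow_card P₀ hD hb]

theorem thinLaw_zero_one (P₀ P₁ : Law X) : thinLaw P₀ P₁ 0 1 = P₁ := by
  refine Law.ext (ext_of_voidEvents fun D hD hb => ?_)
  rw [thinLaw_voidEvent _ _ _ _ hD hb]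
  simp [lintegral_zero_pow_card P₁ hD hb]

theorem integrable_pair (P₀ P₁ : Law X) {D : Set X} (hD : MeasurableSet D)
    (hb : Bornology.IsBounded D) (K : ℝ) :
    Integrable (fun a : Config X × Config X =>
      K * (1 + ((a.1.points hb).card + (a.2.points hb).card : ℝ)))
      (P₀.measure.prod P₁.measure) :=
  ((integrable_const _).add (((Config.integrable_card_points P₀ hD hb).comp_fst _).add
    ((Config.integrable_card_points P₁ hD hb).comp_snd _))).const_mul K

theorem integral_norm_thinUnion_le {F : Config X → ℝ} (hF : Measurable F) {K : ℝ} (hK : 0 ≤ K)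
    {D : Set X} (hb : Bornology.IsBounded D)
    (h : ∀ η : Config X, |F η| ≤ K * (1 + (η.points hb).card)) (p q : I) (ξ ζ : Config X) :
    Integrable F (thinUnion p q ξ ζ) ∧ ∫ η, ‖F η‖ ∂thinUnion p q ξ ζ ≤
      K * (1 + ((ξ.points hb).card + (ζ.points hb).card : ℝ)) := by
  have hm := measurable_retain_union p q ξ ζ
  have hbd : ∀ ω : (ξ.carrier → I) × (ζ.carrier → I),
      ‖F ((ξ.retain p ω.1).union (ζ.retain q ω.2))‖ ≤
        K * (1 + ((ξ.points hb).card + (ζ.points hb).card : ℝ)) := fun ω => by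
    refine (h _).trans (mul_le_mul_of_nonneg_left ?_ hK)
    have := Config.card_points_union_retain_le ξ ζ hb p q ω.1 ω.2
    rw [← Nat.cast_add]
    gcongr
  have hint : Integrable (fun ω => F ((ξ.retain p ω.1).union (ζ.retain q ω.2)))
      ((markLaw ξ).prod (markLaw ζ)) :=
    (integrable_const _).mono' (hF.comp hm).aestronglyMeasurable (Eventually.of_forall hbd)
  rw [thinUnion_eq_map]
  refine ⟨(integrable_map_measure hF.aestronglyMeasurable hm.aemeasurable).2 hint, ?_⟩
  rw [integral_map hm.aemeasurable hF.norm.aestronglyMeasurable]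
  refine (integral_mono hint.norm (integrable_const _) hbd).trans ?_
  simp

theorem integral_thinLaw {F : Config X → ℝ} (hF : Measurable F) {K : ℝ} (hK : 0 ≤ K)
    {D : Set X} (hD : MeasurableSet D) (hb : Bornology.IsBounded D)
    (h : ∀ η : Config X, |F η| ≤ K * (1 + (η.points hb).card)) (P₀ P₁ : Law X) (p q : I) :
    ∫ η, F η ∂(thinLaw P₀ P₁ p q).measure =
      ∫ a, ∫ η, F η ∂thinUnion p q a.1 a.2 ∂(P₀.measure.prod P₁.measure) := by
  have hint : Integrable F (thinPairKernel X p q ∘ₘ (P₀.measure.prod P₁.measure)) := by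
    rw [Measure.integrable_comp_iff hF.aestronglyMeasurable]
    refine ⟨Eventually.of_forall fun a => (integral_norm_thinUnion_le hF hK hb h p q a.1 a.2).1,
      (integrable_pair P₀ P₁ hD hb K).mono' ?_ (Eventually.of_forall fun a => ?_)⟩
    · exact (hF.stronglyMeasurable.norm.integral_kernel).aestronglyMeasurable
    · rw [Real.norm_of_nonneg (integral_nonneg fun _ => norm_nonneg _)]
      exact (integral_norm_thinUnion_le hF hK hb h p q a.1 a.2).2
  rw [Measure.comp_eq_comp_const_apply] at hint
  have := ProbabilityTheory.Kernel.integral_comp hint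
  rw [← Measure.comp_eq_comp_const_apply, Kernel.const_apply] at this
  exact this

/-- Dominated convergence once more, now over both configurations; local integrability of the two
laws makes the bound of the conditional step integrable. -/
theorem tendsto_thinLaw {T : Type*} {l : Filter T} [l.IsCountablyGenerated]
    {p q : T → I} {p₀ q₀ : I} (hp : Tendsto p l (𝓝 p₀)) (hq : Tendsto q l (𝓝 q₀))
    (P₀ P₁ : Law X) :
    Tendsto (fun t => thinLaw P₀ P₁ (p t) (q t)) l (𝓝 (thinLaw P₀ P₁ p₀ q₀)) := by
  rw [nhds_induced, tendsto_comap_iff, tendsto_pi_nhds]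
  rintro ⟨F, hF⟩
  obtain ⟨K, hK, D, hD, hb, h⟩ := hF.exists_bound
  simp only [Function.comp_def]
  simp_rw [integral_thinLaw hF.1 hK hD hb h]
  refine tendsto_integral_filter_of_dominated_convergence _ (Eventually.of_forall fun t => ?_)
    (Eventually.of_forall fun t => Eventually.of_forall fun a => ?_)
    (integrable_pair P₀ P₁ hD hb K)
    (Eventually.of_forall fun a => tendsto_integral_thinUnion hp hq hF a.1 a.2)
  · exact (hF.1.stronglyMeasurable.integral_kernel
      (κ := thinPairKernel X (p t) (q t))).aestronglyMeasurable
  · exact (norm_integral_le_integral_norm _).trans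
      (integral_norm_thinUnion_le hF.1 hK hb h (p t) (q t) a.1 a.2).2

end ThinLaw

/-! ### Jordan decompositions of differences of infinite measures -/

section Jordan

/-- A measurable family of differences of `σ`-finite measures has a measurable family of Jordan
decompositions. -/
theorem exists_kernel_jordanDecomposition {T Y : Type*} [MeasurableSpace T] [MeasurableSpace Y]
    [MeasurableSpace.CountablyGenerated Y] (κ η : Kernel T Y) {w : Y → ℝ≥0∞} (hw : Measurable w)
    (hw0 : ∀ y, w y ≠ 0) (hwt : ∀ y, w y ≠ ⊤) {C : ℝ≥0∞} (hC : C < ⊤)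
    (hκ : ∀ t, ∫⁻ y, w y ∂κ t ≤ C) (hη : ∀ t, ∫⁻ y, w y ∂η t ≤ C) :
    ∃ pos neg : Kernel T Y, ∀ t, pos t ⟂ₘ neg t ∧ pos t + η t = neg t + κ t ∧
      pos t ≤ κ t ∧ neg t ≤ η t := by
  -- The weight `w` makes both kernels finite, so that kernel Radon-Nikodym derivatives with respect
  -- to their sum exist.
  have weighted : ∀ κ : Kernel T Y, (∀ t, ∫⁻ y, w y ∂κ t ≤ C) →
      ∃ κ' : Kernel T Y, IsFiniteKernel κ' ∧ ∀ t, κ' t = (κ t).withDensity w := by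
    intro κ hκ
    refine ⟨⟨fun t => (κ t).withDensity w, Measure.measurable_of_measurable_coe _ fun s hs => ?_⟩,
      ⟨⟨C, hC, fun t => ?_⟩⟩, fun t => rfl⟩
    · simp_rw [withDensity_apply _ hs, ← lintegral_indicator hs]
      exact (hw.indicator hs).lintegral_kernel
    · refine le_trans (le_of_eq ?_) (hκ t)
      rw [Kernel.coe_mk, withDensity_apply _ MeasurableSet.univ, Measure.restrict_univ]
  obtain ⟨κ', _, hκ'⟩ := weighted κ hκ
  obtain ⟨η', _, hη'⟩ := weighted η hη
  let ρ := κ' + η'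
  let f := Kernel.rnDeriv κ' ρ
  let g := Kernel.rnDeriv η' ρ
  have hf : Measurable (Function.uncurry f) := Kernel.measurable_rnDeriv κ' ρ
  have hg : Measurable (Function.uncurry g) := Kernel.measurable_rnDeriv η' ρ
  have hft : ∀ t, Measurable (f t) := fun t => hf.of_uncurry_left
  have hgt : ∀ t, Measurable (g t) := fun t => hg.of_uncurry_left
  -- Dividing by `w` undoes the weighting: the original kernels have densities `f / w` and `g / w`
  -- with respect to `ρ`.
  have recover : ∀ t (κ κ' : Measure Y) (h : Y → ℝ≥0∞), κ' = κ.withDensity w →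
      (ρ t).withDensity h = κ' → Measurable h →
      κ = (ρ t).withDensity (fun y => h y * (w y)⁻¹) := by
    intro t κ κ' h h1 h2 hh
    have : (fun y => h y * (w y)⁻¹) = h * w⁻¹ := rfl
    rw [this, withDensity_mul _ hh hw.inv, h2, h1]
    exact (withDensity_inv_same hw (Eventually.of_forall hw0) (Eventually.of_forall hwt)).symm
  have hκρ : ∀ t, κ t = (ρ t).withDensity (fun y => f t y * (w y)⁻¹) := fun t => by
    refine recover t _ _ _ (hκ' t) ?_ (hft t)
    have hac : κ' t ≪ ρ t := Measure.absolutelyContinuous_of_le (Measure.le_add_right le_rfl)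
    rw [← Kernel.withDensity_rnDeriv_eq hac, Kernel.withDensity_apply _ hf]
  have hηρ : ∀ t, η t = (ρ t).withDensity (fun y => g t y * (w y)⁻¹) := fun t => by
    refine recover t _ _ _ (hη' t) ?_ (hgt t)
    have hac : η' t ≪ ρ t := Measure.absolutelyContinuous_of_le (Measure.le_add_left le_rfl)
    rw [← Kernel.withDensity_rnDeriv_eq hac, Kernel.withDensity_apply _ hg]
  have hwm : Measurable fun a : T × Y => (w a.2)⁻¹ := (hw.comp measurable_snd).inv
  have hp : Measurable (Function.uncurry fun t y => (f t y - g t y) * (w y)⁻¹) :=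
    (hf.sub hg).mul hwm
  have hn : Measurable (Function.uncurry fun t y => (g t y - f t y) * (w y)⁻¹) :=
    (hg.sub hf).mul hwm
  -- Subtraction in `ℝ≥0∞` is truncated, so these are the positive and negative parts of `(f - g) /
  -- w`. They live on disjoint sets, and adding `g` to the one or `f` to the other gives `max f g`.
  refine ⟨ρ.withDensity fun t y => (f t y - g t y) * (w y)⁻¹,
    ρ.withDensity fun t y => (g t y - f t y) * (w y)⁻¹, fun t => ?_⟩
  rw [Kernel.withDensity_apply _ hp, Kernel.withDensity_apply _ hn]
  refine ⟨⟨{y | f t y ≤ g t y}, measurableSet_le (hft t) (hgt t), ?_, ?_⟩, ?_, ?_, ?_⟩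
  · rw [withDensity_apply _ (measurableSet_le (hft t) (hgt t)),
      setLIntegral_congr_fun (measurableSet_le (hft t) (hgt t)) (g := fun _ => 0), lintegral_zero]
    intro y hy
    simp [tsub_eq_zero_of_le (show f t y ≤ g t y from hy)]
  · rw [withDensity_apply _ (measurableSet_le (hft t) (hgt t)).compl,
      setLIntegral_congr_fun (measurableSet_le (hft t) (hgt t)).compl (g := fun _ => 0),
      lintegral_zero]
    intro y hy
    simp [tsub_eq_zero_of_le (not_le.1 (show ¬ f t y ≤ g t y from hy)).le]
  · rw [hκρ, hηρ, ← withDensity_add_left hp.of_uncurry_left, ← withDensity_add_left hn.of_uncurry_left]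
    congr 1
    ext y
    simp only [Pi.add_apply, ← add_mul, tsub_add_eq_max, max_comm]
  · rw [hκρ]
    exact withDensity_mono (Eventually.of_forall fun y => by dsimp only; gcongr; exact tsub_le_self)
  · rw [hηρ]
    exact withDensity_mono (Eventually.of_forall fun y => by dsimp only; gcongr; exact tsub_le_self)

/-- On a null set of `p` there is nothing to show; on its complement `n` vanishes, so `p ≤ p + n' =
p' + n = p'` there. -/
theorem le_of_mutuallySingular_of_add_eq_add {Y : Type*} [MeasurableSpace Y]
    {p n p' n' : Measure Y} (h : p ⟂ₘ n) (he : p + n' = p' + n) : p ≤ p' := by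
  obtain ⟨S, hS, hpS, hnS⟩ := h
  refine Measure.le_iff.2 fun A hA => ?_
  calc p A ≤ p (A ∩ S) + p (A \ S) := measure_le_inter_add_sdiff _ _ _
    _ = p (A \ S) := by rw [measure_mono_null inter_subset_right hpS, zero_add]
    _ ≤ (p + n') (A \ S) := by rw [Measure.add_apply]; exact le_self_add
    _ = p' (A \ S) + n (A \ S) := by rw [he, Measure.add_apply]
    _ = p' (A \ S) := by rw [measure_mono_null (fun x hx => hx.2) hnS, add_zero]
    _ ≤ p' A := measure_mono sdiff_subset

/-- The Jordan decomposition of a difference of `σ`-finite measures is unique. -/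
theorem jordanDecomposition_unique {Y : Type*} [MeasurableSpace Y] {μ ν p n p' n' : Measure Y}
    [SigmaFinite μ] [SigmaFinite ν] (h : p ⟂ₘ n) (h' : p' ⟂ₘ n') (he : p + ν = n + μ)
    (he' : p' + ν = n' + μ) : p = p' ∧ n = n' := by
  -- Both equations describe the same formal difference `μ - ν`; `σ`-finiteness allows cancelling `μ
  -- + ν`.
  have key : p + n' = p' + n := by
    have : (μ + ν) + (p + n') = (μ + ν) + (p' + n) := by
      calc (μ + ν) + (p + n') = (p + ν) + (n' + μ) := by abel
        _ = (p' + ν) + (n + μ) := by rw [he, ← he', add_comm]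
        _ = (μ + ν) + (p' + n) := by abel
    exact (Measure.add_right_inj _ _ _).1 this
  refine ⟨le_antisymm (le_of_mutuallySingular_of_add_eq_add h key)
    (le_of_mutuallySingular_of_add_eq_add h' key.symm),
    le_antisymm (le_of_mutuallySingular_of_add_eq_add h.symm (p' := n') (n' := p') ?_)
    (le_of_mutuallySingular_of_add_eq_add h'.symm (p' := n) (n' := p) ?_)⟩
  · rw [add_comm, ← key, add_comm]
  · rw [add_comm, key, add_comm]

end Jordan

/-! ### The birth mechanism -/

section Birth

variable {X : Type*} [MetricSpace X] [MeasurableSpace X] [BorelSpace X]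
  [SecondCountableTopology X]

/-- The erased configuration avoids `D` iff `ξ (D \ {y}) = 0`, and this count is the integral of a
jointly measurable function against a kernel. -/
theorem measurable_erase : Measurable fun a : Config X × X => a.1.erase a.2 := by
  refine measurable_of_voidEvents fun D hD hb => ?_
  have hm : Measurable fun a : (Config X × X) × X =>
      (D ∩ {a.1.2}ᶜ).indicator (1 : X → ℝ≥0∞) a.2 := by
    have hs : MeasurableSet {a : (Config X × X) × X | a.2 ∈ D ∩ {a.1.2}ᶜ} :=
      (measurable_snd hD).inter (measurableSet_eq_fun measurable_snd
        (measurable_snd.comp measurable_fst)).compl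
    exact measurable_one.indicator hs
  let κ : Kernel (Config X × X) X := (countingKernel X).comap Prod.fst measurable_fst
  have h := hm.lintegral_kernel_prod_right' (κ := κ)
  have : (fun a : Config X × X => a.1.erase a.2) ⁻¹' voidEvent D =
      (fun a : Config X × X => ∫⁻ x, (D ∩ {a.2}ᶜ).indicator (1 : X → ℝ≥0∞) x ∂κ a) ⁻¹' {0} := by
    ext a
    have hs : MeasurableSet (D ∩ {a.2}ᶜ) := hD.inter (measurableSet_singleton _).compl
    rw [mem_preimage, mem_preimage, mem_singleton_iff, lintegral_indicator_one hs,
      Kernel.comap_apply, countingKernel_apply, Config.toMeasure_eq_zero_iff _ hs]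
    simp only [voidEvent, Config.erase, Config.restrict, mem_ofPred_eq, disjoint_iff_inter_eq_empty]
    rw [inter_assoc, inter_comm {a.2}ᶜ]
  rw [this]
  exact h (measurableSet_singleton 0)

/-- The Campbell measure of the second of two independent configurations. -/
noncomputable def campbell (P₀ P₁ : Law X) : Measure ((Config X × Config X) × X) :=
  (P₀.measure.prod P₁.measure) ⊗ₘ (countingKernel X).comap Prod.snd measurable_snd

instance (P₀ P₁ : Law X) : SFinite (campbell P₀ P₁) := by unfold campbell; infer_instance

variable (X) in
/-- The superposition of independent thinnings, after erasing one point of the second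
configuration. -/
noncomputable def thinEraseKernel : Kernel ((I × I) × (Config X × Config X) × X) (Config X) :=
  (thinUnionKernel X).comap (fun b => (b.1, b.2.1.1, b.2.1.2.erase b.2.2)) <|
    measurable_fst.prodMk ((by fun_prop : Measurable fun b : (I × I) × (Config X × Config X) × X =>
      b.2.1.1).prodMk (measurable_erase.comp (by fun_prop : Measurable
        fun b : (I × I) × (Config X × Config X) × X => (b.2.1.2, b.2.2))))

theorem thinEraseKernel_apply (b : (I × I) × (Config X × Config X) × X) :
    thinEraseKernel X b = thinUnion b.1.1 b.1.2 b.2.1.1 (b.2.1.2.erase b.2.2) := rfl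

instance : IsMarkovKernel (thinEraseKernel X) := by unfold thinEraseKernel; infer_instance

/-- The rate at which points of the second configuration are added to the superposition. -/
noncomputable def birthKernel (P₀ P₁ : Law X) : Kernel (I × I) (Config X × X) :=
  (Kernel.const (I × I) (campbell P₀ P₁) ⊗ₖ thinEraseKernel X).map fun c => (c.2, c.1.2)

/-- The integral of `G` for the birth mechanism, conditionally on both configurations. -/
noncomputable def birthIntegral (r : I × I) (G : Config X × X → ℝ≥0∞) (a : Config X × Config X) :
    ℝ≥0∞ :=
  ∫⁻ y, ∫⁻ η, G (η, y) ∂thinUnion r.1 r.2 a.1 (a.2.erase y) ∂a.2.toMeasure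

theorem measurable_lintegral_thinErase (r : I × I) {G : Config X × X → ℝ≥0∞} (hG : Measurable G) :
    Measurable fun b : (Config X × Config X) × X =>
      ∫⁻ η, G (η, b.2) ∂thinUnion r.1 r.2 b.1.1 (b.1.2.erase b.2) :=
  Measurable.lintegral_kernel_prod_right'
    (κ := (thinEraseKernel X).comap (fun b => (r, b)) measurable_prodMk_left)
    (f := fun c : ((Config X × Config X) × X) × Config X => G (c.2, c.1.2)) (by fun_prop)

theorem measurable_birthIntegral (r : I × I) {G : Config X × X → ℝ≥0∞} (hG : Measurable G) :
    Measurable (birthIntegral r G) :=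
  (measurable_lintegral_thinErase r hG).lintegral_kernel_prod_right'
    (κ := (countingKernel X).comap Prod.snd measurable_snd)

theorem lintegral_birthKernel (P₀ P₁ : Law X) (r : I × I) {G : Config X × X → ℝ≥0∞}
    (hG : Measurable G) :
    ∫⁻ z, G z ∂birthKernel P₀ P₁ r =
      ∫⁻ ξ, ∫⁻ ζ, birthIntegral r G (ξ, ζ) ∂P₁.measure ∂P₀.measure := by
  have hm : Measurable fun c : ((Config X × Config X) × X) × Config X => (c.2, c.1.2) := by
    fun_prop
  rw [birthKernel, Kernel.lintegral_map _ hm _ hG,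
    Kernel.lintegral_compProd _ _ _ (by fun_prop), Kernel.const_apply, campbell]
  simp only [thinEraseKernel_apply]
  rw [Measure.lintegral_compProd (measurable_lintegral_thinErase r hG)]
  exact lintegral_prod _ (measurable_birthIntegral r hG).aemeasurable

/-- Deaths are births with the laws exchanged, whereas the interpolation integrates over `P₀` last
in both terms; Tonelli reconciles the orders. -/
theorem lintegral_birthKernel_swap (P₀ P₁ : Law X) (r : I × I) {G : Config X × X → ℝ≥0∞}
    (hG : Measurable G) :
    ∫⁻ z, G z ∂birthKernel P₀ P₁ r =
      ∫⁻ ζ, ∫⁻ ξ, birthIntegral r G (ξ, ζ) ∂P₀.measure ∂P₁.measure := by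
  rw [lintegral_birthKernel P₀ P₁ r hG]
  exact lintegral_lintegral_swap (f := fun ξ ζ => birthIntegral r G (ξ, ζ))
    (measurable_birthIntegral r hG).aemeasurable

/-- The thinning kernel is Markov, so the spatial marginal is the intensity measure of `P₁`,
whatever the retention probabilities. All bounds uniform in time come from this. -/
theorem birthKernel_univ_prod (P₀ P₁ : Law X) (r : I × I) {D : Set X} (hD : MeasurableSet D) :
    birthKernel P₀ P₁ r (univ ×ˢ D) = ∫⁻ ζ, ζ.toMeasure D ∂P₁.measure := by
  have hs : MeasurableSet ((univ : Set (Config X)) ×ˢ D) := MeasurableSet.univ.prod hD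
  rw [← lintegral_indicator_one hs, lintegral_birthKernel P₀ P₁ r (measurable_one.indicator hs)]
  have : ∀ ξ ζ : Config X, birthIntegral r ((univ ×ˢ D).indicator 1) (ξ, ζ) = ζ.toMeasure D := by
    intro ξ ζ
    rw [birthIntegral, ← lintegral_indicator_one hD]
    refine lintegral_congr fun y => ?_
    by_cases hy : y ∈ D <;> simp [hy]
  simp [this]

end Birth

/-! ### Laplace functionals of thinnings and their derivatives -/

section Laplace

variable {X : Type*} [MetricSpace X]

/-- `1 - e^{-f}`. -/
noncomputable def killing (f : X → ℝ) (x : X) : ℝ := 1 - Real.exp (-f x)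

theorem killing_nonneg {f : X → ℝ} (hf : ∀ x, 0 ≤ f x) (x : X) : 0 ≤ killing f x := by
  simpa [killing] using hf x

theorem killing_le_one (f : X → ℝ) (x : X) : killing f x ≤ 1 := by
  simpa [killing] using (Real.exp_pos (-f x)).le

/-- The Laplace functional of the thinning of `ξ`, for `f` vanishing outside a bounded set. -/
noncomputable def thinLaplace (f : X → ℝ) {D : Set X} (hb : Bornology.IsBounded D) (s : ℝ)
    (ξ : Config X) : ℝ :=
  ∏ x ∈ ξ.points hb, (1 - s * killing f x)

/-- Minus the derivative of the Laplace functional of the thinning of `ξ` in the retention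
probability. -/
noncomputable def thinLaplaceRate (f : X → ℝ) {D : Set X} (hb : Bornology.IsBounded D) (s : ℝ)
    (ξ : Config X) : ℝ :=
  ∑ y ∈ ξ.points hb, killing f y * thinLaplace f hb s (ξ.erase y)

theorem Config.points_erase [DecidableEq X] (ξ : Config X) {D : Set X}
    (hb : Bornology.IsBounded D) (y : X) :
    (ξ.erase y).points hb = (ξ.points hb).erase y := by
  ext x
  simp only [Config.mem_points, Config.erase, Config.restrict, Finset.mem_erase, mem_inter_iff,
    mem_compl_iff, mem_singleton_iff]
  tauto

theorem thinFactor_mem {f : X → ℝ} (hf : ∀ x, 0 ≤ f x) {s : ℝ} (hs : s ∈ Icc (0 : ℝ) 1)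
    (x : X) : 1 - s * killing f x ∈ Icc (0 : ℝ) 1 := by
  have h1 := killing_nonneg hf x
  have h2 := killing_le_one f x
  constructor <;> nlinarith [hs.1, hs.2]

theorem thinLaplace_mem {f : X → ℝ} {D : Set X} (hb : Bornology.IsBounded D)
    (hf : ∀ x, 0 ≤ f x) {s : ℝ} (hs : s ∈ Icc (0 : ℝ) 1)
    (ξ : Config X) : thinLaplace f hb s ξ ∈ Icc (0 : ℝ) 1 :=
  ⟨Finset.prod_nonneg fun x _ => (thinFactor_mem hf hs x).1,
    Finset.prod_le_one (fun x _ => (thinFactor_mem hf hs x).1)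
      fun x _ => (thinFactor_mem hf hs x).2⟩

theorem thinLaplaceRate_mem {f : X → ℝ} {D : Set X} (hb : Bornology.IsBounded D)
    (hf : ∀ x, 0 ≤ f x) {s : ℝ} (hs : s ∈ Icc (0 : ℝ) 1)
    (ξ : Config X) :
    thinLaplaceRate f hb s ξ ∈ Icc (0 : ℝ) (ξ.points hb).card := by
  constructor
  · exact Finset.sum_nonneg fun x _ =>
      mul_nonneg (killing_nonneg hf x) (thinLaplace_mem hb hf hs _).1
  · have := Finset.sum_le_card_nsmul (ξ.points hb)
      (fun y => killing f y * thinLaplace f hb s (ξ.erase y)) 1 fun y _ =>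
        mul_le_one₀ (killing_le_one f y) (thinLaplace_mem hb hf hs _).1 (thinLaplace_mem hb hf hs _).2
    rw [nsmul_one] at this
    exact this

/-- In the product rule, differentiating the factor of `y` leaves the product over the other points,
which is the functional of `ξ.erase y`. -/
theorem hasDerivAt_thinLaplace (f : X → ℝ) {D : Set X} (hb : Bornology.IsBounded D) (ξ : Config X)
    (s : ℝ) :
    HasDerivAt (fun s => thinLaplace f hb s ξ) (-thinLaplaceRate f hb s ξ) s := by
  classical
  have h := HasDerivAt.fun_finsetProd (u := ξ.points hb) (x := s)
    (f := fun x s => 1 - s * killing f x) (f' := fun x => -killing f x) fun x _ => by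
      simpa using ((hasDerivAt_id s).mul_const (killing f x)).const_sub 1
  refine h.congr_deriv ?_
  rw [thinLaplaceRate, ← Finset.sum_neg_distrib]
  refine Finset.sum_congr rfl fun y _ => ?_
  rw [thinLaplace, Config.points_erase, smul_eq_mul]
  ring

theorem continuous_thinLaplaceRate (f : X → ℝ) {D : Set X} (hb : Bornology.IsBounded D)
    (ξ : Config X) : Continuous fun s => thinLaplaceRate f hb s ξ := by
  unfold thinLaplaceRate thinLaplace
  fun_prop

variable [MeasurableSpace X] [BorelSpace X]

theorem expFunctional_toMeasure {f : X → ℝ} {D : Set X} (hD : MeasurableSet D)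
    (hb : Bornology.IsBounded D) (hfD : ∀ x, x ∉ D → f x = 0) (ξ : Config X) :
    expFunctional f ξ.toMeasure = ∏ x ∈ ξ.points hb, Real.exp (-f x) := by
  rw [expFunctional, ξ.integral_toMeasure hD hb hfD, ← Finset.sum_neg_distrib, Real.exp_sum]

theorem expFunctional_mem {f : X → ℝ} (hf0 : ∀ x, 0 ≤ f x) (ξ : Config X) :
    expFunctional f ξ.toMeasure ∈ Icc (0 : ℝ) 1 :=
  ⟨(Real.exp_pos _).le, Real.exp_le_one_iff.2 (neg_nonpos.2 (integral_nonneg hf0))⟩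

theorem measurable_expFunctional {f : X → ℝ} (hf : Measurable f) :
    Measurable fun ξ : Config X => expFunctional f ξ.toMeasure := by
  have h := (hf.stronglyMeasurable.integral_kernel (κ := countingKernel X)).measurable
  exact h.neg.exp

/-- The marks are independent, and a point contributes `e^{-f x}` if kept and `1` if deleted, with
mean `1 - p (1 - e^{-f x})`. -/
theorem integral_expFunctional_retain {f : X → ℝ} {D : Set X} (hD : MeasurableSet D)
    (hb : Bornology.IsBounded D) (hfD : ∀ x, x ∉ D → f x = 0) (p : I) (ξ : Config X) :
    ∫ ω, expFunctional f (ξ.retain p ω).toMeasure ∂markLaw ξ = thinLaplace f hb p ξ := by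
  let φ : ξ.carrier → I → ℝ := fun x u => if u < p then Real.exp (-f x) else 1
  have hφ : ∀ x, Measurable (φ x) := fun x =>
    Measurable.ite measurableSet_Iio measurable_const measurable_const
  have h1 : ∀ ω : ξ.carrier → I, expFunctional f (ξ.retain p ω).toMeasure =
      ∏ x : ξ.indices hb, φ x.1 ((ξ.indices hb).restrict ω x) := by
    intro ω
    rw [expFunctional_toMeasure hD hb hfD, ← Config.map_indices_retain, Finset.prod_map,
      Finset.prod_filter]
    exact (Finset.prod_coe_sort (ξ.indices hb) fun x => φ x (ω x)).symm
  have h2 : ∀ x, ∫ u, φ x u = 1 - p * killing f x := by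
    intro x
    have : φ x = fun u => 1 - (Iio p).indicator (fun _ => killing f x) u := by
      ext u
      by_cases h : u < p <;> simp [φ, h, killing]
    rw [this, integral_sub (integrable_const _)
      ((integrable_const _).indicator measurableSet_Iio), integral_indicator measurableSet_Iio]
    simp [measureReal_def, p.2.1]
  simp_rw [h1]
  rw [markLaw, integral_restrict_infinitePi (μ := fun _ : ξ.carrier => (volume : Measure I))
    (f := fun y => ∏ x : ξ.indices hb, φ x.1 (y x)),
    integral_fintype_prod_eq_prod (fun (x : ξ.indices hb) u => φ x.1 u)]
  · simp_rw [h2]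
    rw [Finset.prod_coe_sort (ξ.indices hb) fun x => 1 - (p : ℝ) * killing f x, thinLaplace,
      ← ξ.map_indices hb, Finset.prod_map]
    rfl
  · refine Measurable.aestronglyMeasurable ?_
    exact Finset.measurable_fun_prod _ fun x _ => (hφ x.1).comp (measurable_pi_apply x)

variable [SecondCountableTopology X]

/-- Without common points the exponential of the union factorizes, and the two families of marks are
independent. -/
theorem integral_expFunctional_thinUnion {f : X → ℝ} (hf : Measurable f) {D : Set X}
    (hD : MeasurableSet D) (hb : Bornology.IsBounded D) (hfD : ∀ x, x ∉ D → f x = 0) {p q : I}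
    {ξ ζ : Config X} (h : Compatible p q ξ ζ) :
    ∫ η, expFunctional f η.toMeasure ∂thinUnion p q ξ ζ =
      thinLaplace f hb p ξ * thinLaplace f hb q ζ := by
  rw [thinUnion_eq_map, integral_map (measurable_retain_union p q ξ ζ).aemeasurable
    (measurable_expFunctional hf).aestronglyMeasurable,
    ← integral_expFunctional_retain hD hb hfD, ← integral_expFunctional_retain hD hb hfD,
    ← integral_prod_mul]
  refine integral_congr_ae (Eventually.of_forall fun ω => ?_)
  dsimp only
  rw [expFunctional, Config.toMeasure_union (h.disjoint_retain ω.1 ω.2), integral_add_measure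
    (Config.integrable_toMeasure _ hD hb hfD) (Config.integrable_toMeasure _ hD hb hfD), neg_add,
    Real.exp_add]
  rfl

theorem measurable_thinLaplace {f : X → ℝ} (hf : Measurable f) {D : Set X}
    (hD : MeasurableSet D) (hb : Bornology.IsBounded D) (hfD : ∀ x, x ∉ D → f x = 0) {s : ℝ}
    (hs : s ∈ Icc (0 : ℝ) 1) : Measurable (thinLaplace f hb s) := by
  -- Taking `ξ` twice with second retention `0` is compatible and makes the second factor `1`, so
  -- measurability is inherited from a kernel.
  have h : thinLaplace f hb s = fun ξ => ∫ η, expFunctional f η.toMeasure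
      ∂thinPairKernel X ⟨s, hs⟩ 0 (ξ, ξ) := by
    ext ξ
    rw [thinPairKernel_apply,
      integral_expFunctional_thinUnion hf hD hb hfD (Or.inr (Or.inr rfl))]
    simp [thinLaplace]
  rw [h]
  exact ((measurable_expFunctional hf).stronglyMeasurable.integral_kernel).measurable.comp
    (measurable_id.prodMk measurable_id)

theorem measurable_thinLaplaceRate {f : X → ℝ} (hf : Measurable f) {D : Set X}
    (hD : MeasurableSet D) (hb : Bornology.IsBounded D) (hfD : ∀ x, x ∉ D → f x = 0) {s : ℝ}
    (hs : s ∈ Icc (0 : ℝ) 1) : Measurable (thinLaplaceRate f hb s) := by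
  have h : thinLaplaceRate f hb s = fun ξ =>
      ∫ y, killing f y * thinLaplace f hb s (ξ.erase y) ∂countingKernel X ξ := by
    ext ξ
    rw [countingKernel_apply, ξ.integral_toMeasure hD hb fun x hx => by simp [killing, hfD x hx]]
    rfl
  have hm : Measurable fun a : Config X × X => killing f a.2 * thinLaplace f hb s (a.1.erase a.2) :=
    (by unfold killing; fun_prop : Measurable fun a : Config X × X => killing f a.2).mul
      ((measurable_thinLaplace hf hD hb hfD hs).comp measurable_erase)
  rw [h]
  exact hm.stronglyMeasurable.integral_kernel_prod_right'.measurable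

/-- The Laplace functional of the thinning of a law. -/
noncomputable def Law.thinLaplace (P : Law X) (f : X → ℝ) {D : Set X}
    (hb : Bornology.IsBounded D) (s : ℝ) : ℝ :=
  ∫ ξ, PointProcess.thinLaplace f hb s ξ ∂P.measure

/-- Minus the derivative of the Laplace functional of the thinning of a law. -/
noncomputable def Law.thinLaplaceRate (P : Law X) (f : X → ℝ) {D : Set X}
    (hb : Bornology.IsBounded D) (s : ℝ) : ℝ :=
  ∫ ξ, PointProcess.thinLaplaceRate f hb s ξ ∂P.measure

theorem integrable_thinLaplace {f : X → ℝ} (hf : Measurable f) (hf0 : ∀ x, 0 ≤ f x)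
    {D : Set X} (hD : MeasurableSet D) (hb : Bornology.IsBounded D)
    (hfD : ∀ x, x ∉ D → f x = 0) (P : Law X)
    {s : ℝ} (hs : s ∈ Icc (0 : ℝ) 1) :
    Integrable (thinLaplace f hb s) P.measure :=
  (integrable_const 1).mono' (measurable_thinLaplace hf hD hb hfD hs).aestronglyMeasurable <|
    Eventually.of_forall fun ξ => by
      rw [Real.norm_of_nonneg (thinLaplace_mem hb hf0 hs ξ).1]
      exact (thinLaplace_mem hb hf0 hs ξ).2

theorem integrable_thinLaplaceRate {f : X → ℝ} (hf : Measurable f) (hf0 : ∀ x, 0 ≤ f x)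
    {D : Set X} (hD : MeasurableSet D) (hb : Bornology.IsBounded D)
    (hfD : ∀ x, x ∉ D → f x = 0) (P : Law X)
    {s : ℝ} (hs : s ∈ Icc (0 : ℝ) 1) :
    Integrable (thinLaplaceRate f hb s) P.measure :=
  (Config.integrable_card_points P hD hb).mono'
    (measurable_thinLaplaceRate hf hD hb hfD hs).aestronglyMeasurable <|
    Eventually.of_forall fun ξ => by
      rw [Real.norm_of_nonneg (thinLaplaceRate_mem hb hf0 hs ξ).1]
      exact (thinLaplaceRate_mem hb hf0 hs ξ).2

theorem continuousOn_law_thinLaplace {f : X → ℝ} (hf : Measurable f) (hf0 : ∀ x, 0 ≤ f x)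
    {D : Set X} (hD : MeasurableSet D) (hb : Bornology.IsBounded D)
    (hfD : ∀ x, x ∉ D → f x = 0) (P : Law X) :
    ContinuousOn (P.thinLaplace f hb) (Icc 0 1) :=
  continuousOn_of_dominated (bound := fun _ => 1)
    (fun s hs => (integrable_thinLaplace hf hf0 hD hb hfD P hs).1)
    (fun s hs => Eventually.of_forall fun ξ => by
      rw [Real.norm_of_nonneg (thinLaplace_mem hb hf0 hs ξ).1]
      exact (thinLaplace_mem hb hf0 hs ξ).2) (integrable_const _)
    (Eventually.of_forall fun ξ s _ =>
      (hasDerivAt_thinLaplace f hb ξ s).continuousAt.continuousWithinAt)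

theorem continuousOn_law_thinLaplaceRate {f : X → ℝ} (hf : Measurable f)
    (hf0 : ∀ x, 0 ≤ f x) {D : Set X} (hD : MeasurableSet D) (hb : Bornology.IsBounded D)
    (hfD : ∀ x, x ∉ D → f x = 0) (P : Law X) :
    ContinuousOn (P.thinLaplaceRate f hb) (Icc 0 1) :=
  continuousOn_of_dominated (bound := fun ξ => ((ξ.points hb).card : ℝ))
    (fun s hs => (integrable_thinLaplaceRate hf hf0 hD hb hfD P hs).1)
    (fun s hs => Eventually.of_forall fun ξ => by
      rw [Real.norm_of_nonneg (thinLaplaceRate_mem hb hf0 hs ξ).1]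
      exact (thinLaplaceRate_mem hb hf0 hs ξ).2) (Config.integrable_card_points P hD hb)
    (Eventually.of_forall fun ξ => (continuous_thinLaplaceRate f hb ξ).continuousOn)

/-- The derivative is dominated by the number of points in `D`, which is integrable by membership in
`𝒫₁`. -/
theorem hasDerivAt_law_thinLaplace {f : X → ℝ} (hf : Measurable f) (hf0 : ∀ x, 0 ≤ f x)
    {D : Set X} (hD : MeasurableSet D) (hb : Bornology.IsBounded D)
    (hfD : ∀ x, x ∉ D → f x = 0) (P : Law X)
    {s : ℝ} (hs : s ∈ Ioo (0 : ℝ) 1) :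
    HasDerivAt (P.thinLaplace f hb) (-P.thinLaplaceRate f hb s) s := by
  have hsub : Ioo (0 : ℝ) 1 ⊆ Icc 0 1 := Ioo_subset_Icc_self
  have h := hasDerivAt_integral_of_dominated_loc_of_deriv_le (μ := P.measure)
    (F := fun s ξ => thinLaplace f hb s ξ) (F' := fun s ξ => -thinLaplaceRate f hb s ξ)
    (bound := fun ξ => ((ξ.points hb).card : ℝ)) (Ioo_mem_nhds hs.1 hs.2)
    (by filter_upwards [Ioo_mem_nhds hs.1 hs.2] with r hr
        exact (integrable_thinLaplace hf hf0 hD hb hfD P (hsub hr)).1)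
    (integrable_thinLaplace hf hf0 hD hb hfD P (hsub hs))
    (integrable_thinLaplaceRate hf hf0 hD hb hfD P (hsub hs)).1.neg
    (Eventually.of_forall fun ξ r hr => by
      rw [norm_neg, Real.norm_of_nonneg (thinLaplaceRate_mem hb hf0 (hsub hr) ξ).1]
      exact (thinLaplaceRate_mem hb hf0 (hsub hr) ξ).2)
    (Config.integrable_card_points P hD hb)
    (Eventually.of_forall fun ξ r _ => hasDerivAt_thinLaplace f hb ξ r)
  rw [integral_neg] at h
  exact h.2

theorem integral_expFunctional_thinLaw {f : X → ℝ} (hf : Measurable f) (hf0 : ∀ x, 0 ≤ f x)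
    {D : Set X} (hD : MeasurableSet D) (hb : Bornology.IsBounded D)
    (hfD : ∀ x, x ∉ D → f x = 0) (P₀ P₁ : Law X)
    {p q : I}
    (hc : ∀ᵐ a ∂(P₀.measure.prod P₁.measure), Compatible p q a.1 a.2) :
    ∫ η, expFunctional f η.toMeasure ∂(thinLaw P₀ P₁ p q).measure =
      P₀.thinLaplace f hb p * P₁.thinLaplace f hb q := by
  rw [integral_thinLaw (measurable_expFunctional hf) zero_le_one hD hb (fun η => ?_) P₀ P₁ p q,
    Law.thinLaplace, Law.thinLaplace, ← integral_prod_mul]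
  · exact integral_congr_ae (hc.mono fun a ha => integral_expFunctional_thinUnion hf hD hb hfD ha)
  · have h := expFunctional_mem hf0 η
    rw [abs_of_nonneg h.1, one_mul]
    exact h.2.trans (by simp)

theorem addOneCost_expFunctional {f : X → ℝ} {D : Set X} (hD : MeasurableSet D)
    (hb : Bornology.IsBounded D) (hfD : ∀ x, x ∉ D → f x = 0) (z : Config X × X) :
    addOneCost (expFunctional f) z = -(expFunctional f z.1.toMeasure * killing f z.2) := by
  rw [addOneCost, expFunctional, integral_add_measure (Config.integrable_toMeasure _ hD hb hfD)
    (integrable_dirac (by simp)), integral_dirac, neg_add, Real.exp_add, expFunctional, killing]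
  ring

theorem measurable_addOneCost {f : X → ℝ} (hf : Measurable f) {D : Set X} (hD : MeasurableSet D) (hb : Bornology.IsBounded D)
    (hfD : ∀ x, x ∉ D → f x = 0) :
    Measurable (addOneCost (X := X) (expFunctional f)) := by
  have : addOneCost (X := X) (expFunctional f) = fun z =>
      -(expFunctional f z.1.toMeasure * killing f z.2) :=
    funext (addOneCost_expFunctional hD hb hfD)
  rw [this]
  exact ((measurable_expFunctional hf).comp measurable_fst).mul
    (by unfold killing; fun_prop : Measurable fun z : Config X × X => killing f z.2) |>.neg

theorem norm_addOneCost_le {f : X → ℝ} (hf0 : ∀ x, 0 ≤ f x) {D : Set X}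
    (hD : MeasurableSet D) (hb : Bornology.IsBounded D) (hfD : ∀ x, x ∉ D → f x = 0)
    (z : Config X × X) :
    ‖addOneCost (expFunctional f) z‖ ≤ (univ ×ˢ D : Set (Config X × X)).indicator 1 z := by
  have h1 := expFunctional_mem hf0 z.1
  have h2 := killing_nonneg hf0 z.2
  have h3 := killing_le_one f z.2
  rw [addOneCost_expFunctional hD hb hfD, norm_neg, Real.norm_of_nonneg (mul_nonneg h1.1 h2)]
  by_cases hz : z.2 ∈ D
  · rw [indicator_of_mem (by simp [hz])]
    exact mul_le_one₀ h1.2 h2 h3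
  · rw [killing, hfD z.2 hz, indicator_of_notMem (by simp [hz])]
    simp

theorem integrable_addOneCost {f : X → ℝ} (hf : Measurable f) (hf0 : ∀ x, 0 ≤ f x)
    {D : Set X} (hD : MeasurableSet D) (hb : Bornology.IsBounded D)
    (hfD : ∀ x, x ∉ D → f x = 0)
    {μ : Measure (Config X × X)} (hμ : μ (univ ×ˢ D) < ⊤) :
    Integrable (addOneCost (expFunctional f)) μ := by
  refine Integrable.mono' (g := (univ ×ˢ D : Set (Config X × X)).indicator 1) ?_
    (measurable_addOneCost hf hD hb hfD).aestronglyMeasurable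
    (Eventually.of_forall (norm_addOneCost_le hf0 hD hb hfD))
  exact (integrable_indicator_iff (MeasurableSet.univ.prod hD)).2 (integrableOn_const hμ.ne)

/-- This matches births with the derivative: given the erased point `y`, the thinned rest has
Laplace functional `L_p(ξ) L_q(ζ - δ_y)`, and summing over `y` with weight `1 - e^{-f y}` yields the
rate of `ζ`. Signs are flipped to stay in `ℝ≥0∞`. -/
theorem birthIntegral_addOneCost {f : X → ℝ} (hf : Measurable f) (hf0 : ∀ x, 0 ≤ f x)
    {D : Set X} (hD : MeasurableSet D) (hb : Bornology.IsBounded D)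
    (hfD : ∀ x, x ∉ D → f x = 0)
    {p q : I} {ξ ζ : Config X} (h : Compatible p q ξ ζ) :
    birthIntegral (p, q) (fun z => ENNReal.ofReal (-addOneCost (expFunctional f) z)) (ξ, ζ) =
      ENNReal.ofReal (thinLaplace f hb p ξ) * ENNReal.ofReal (thinLaplaceRate f hb q ζ) := by
  have hin : ∀ y, ∫⁻ η, ENNReal.ofReal (-addOneCost (expFunctional f) (η, y))
      ∂thinUnion p q ξ (ζ.erase y) =
      ENNReal.ofReal (killing f y * (thinLaplace f hb p ξ * thinLaplace f hb q (ζ.erase y))) := by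
    intro y
    rw [← integral_expFunctional_thinUnion hf hD hb hfD (h.mono_right inter_subset_left),
      ← integral_const_mul, ofReal_integral_eq_lintegral_ofReal]
    · refine lintegral_congr fun η => ?_
      rw [addOneCost_expFunctional hD hb hfD, neg_neg, mul_comm]
    · refine Integrable.const_mul ((integrable_const 1).mono'
        (measurable_expFunctional hf).aestronglyMeasurable (Eventually.of_forall fun η => ?_)) _
      rw [Real.norm_of_nonneg (expFunctional_mem hf0 η).1]
      exact (expFunctional_mem hf0 η).2
    · exact Eventually.of_forall fun η =>
        mul_nonneg (killing_nonneg hf0 y) (expFunctional_mem hf0 η).1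
  rw [birthIntegral]
  simp only [hin]
  rw [← setLIntegral_eq_of_support_subset (s := D), ζ.setLIntegral_toMeasure hD hb,
    ← ENNReal.ofReal_sum_of_nonneg, ← ENNReal.ofReal_mul (thinLaplace_mem hb hf0 p.2 ξ).1,
    thinLaplaceRate, Finset.mul_sum]
  · refine congrArg _ (Finset.sum_congr rfl fun y _ => by ring)
  · exact fun y _ => mul_nonneg (killing_nonneg hf0 y)
      (mul_nonneg (thinLaplace_mem hb hf0 p.2 ξ).1 (thinLaplace_mem hb hf0 q.2 _).1)
  · intro y hy
    by_contra hyD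
    exact hy (by simp [killing, hfD y hyD])

theorem integral_birthKernel_addOneCost {f : X → ℝ} (hf : Measurable f) (hf0 : ∀ x, 0 ≤ f x)
    {D : Set X} (hD : MeasurableSet D) (hb : Bornology.IsBounded D)
    (hfD : ∀ x, x ∉ D → f x = 0) (P₀ P₁ : Law X)
    {p q : I}
    (hc : ∀ᵐ a ∂(P₀.measure.prod P₁.measure), Compatible p q a.1 a.2) :
    ∫ z, addOneCost (expFunctional f) z ∂birthKernel P₀ P₁ (p, q) =
      -(P₀.thinLaplace f hb p * P₁.thinLaplaceRate f hb q) := by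
  have hm := measurable_addOneCost (X := X) hf hD hb hfD
  have hG : Measurable fun z : Config X × X => ENNReal.ofReal (-addOneCost (expFunctional f) z) :=
    hm.neg.ennreal_ofReal
  have h0 : ∀ z : Config X × X, 0 ≤ -addOneCost (expFunctional f) z := fun z => by
    rw [addOneCost_expFunctional hD hb hfD, neg_neg]
    exact mul_nonneg (expFunctional_mem hf0 z.1).1 (killing_nonneg hf0 z.2)
  rw [← neg_inj, ← integral_neg, neg_neg, integral_eq_lintegral_of_nonneg_ae
    (Eventually.of_forall h0) hm.neg.aestronglyMeasurable,
    lintegral_birthKernel _ _ _ hG]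
  have h1 : ∫⁻ ξ, ∫⁻ ζ, birthIntegral (p, q)
      (fun z => ENNReal.ofReal (-addOneCost (expFunctional f) z)) (ξ, ζ) ∂P₁.measure ∂P₀.measure =
      ∫⁻ ξ, ∫⁻ ζ, ENNReal.ofReal (thinLaplace f hb p ξ) *
        ENNReal.ofReal (thinLaplaceRate f hb q ζ) ∂P₁.measure ∂P₀.measure := by
    refine lintegral_congr_ae ((Measure.ae_ae_of_ae_prod hc).mono fun ξ hξ => ?_)
    exact lintegral_congr_ae (hξ.mono fun ζ h => birthIntegral_addOneCost hf hf0 hD hb hfD h)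
  have m0 := (measurable_thinLaplace hf hD hb hfD p.2).ennreal_ofReal
  have m1 := (measurable_thinLaplaceRate hf hD hb hfD q.2).ennreal_ofReal
  rw [h1]
  simp_rw [lintegral_const_mul _ m1]
  rw [lintegral_mul_const _ m0, ← ofReal_integral_eq_lintegral_ofReal
      (integrable_thinLaplace hf hf0 hD hb hfD P₀ p.2)
      (Eventually.of_forall fun ξ => (thinLaplace_mem hb hf0 p.2 ξ).1),
    ← ofReal_integral_eq_lintegral_ofReal
      (integrable_thinLaplaceRate hf hf0 hD hb hfD P₁ q.2)
      (Eventually.of_forall fun ξ => (thinLaplaceRate_mem hb hf0 q.2 ξ).1),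
    ENNReal.toReal_mul, ENNReal.toReal_ofReal, ENNReal.toReal_ofReal]
  · rfl
  · exact integral_nonneg fun ξ => (thinLaplaceRate_mem hb hf0 q.2 ξ).1
  · exact integral_nonneg fun ξ => (thinLaplace_mem hb hf0 p.2 ξ).1

end Laplace

/-! ### Construction of the velocity field -/

section Velocity

variable {X : Type*} [MetricSpace X] [MeasurableSpace X] [BorelSpace X]

theorem sigmaFinite_of_isBounded {μ : Measure X}
    (h : ∀ D : Set X, MeasurableSet D → Bornology.IsBounded D → μ D < ⊤) : SigmaFinite μ := by
  rcases isEmpty_or_nonempty X with hX | ⟨⟨x₀⟩⟩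
  · rw [Measure.eq_zero_of_isEmpty μ]; infer_instance
  · exact ⟨⟨⟨fun n : ℕ => Metric.ball x₀ n, fun _ => trivial,
      fun n => h _ measurableSet_ball Metric.isBounded_ball, Metric.iUnion_ball_nat x₀⟩⟩⟩

theorem sigmaFinite_of_univ_prod {Y : Type*} [MeasurableSpace Y] {μ : Measure (Y × X)}
    (h : ∀ D : Set X, MeasurableSet D → Bornology.IsBounded D → μ (univ ×ˢ D) < ⊤) :
    SigmaFinite μ := by
  refine SigmaFinite.of_map μ measurable_snd.aemeasurable (sigmaFinite_of_isBounded fun D hD hb => ?_)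
  rw [Measure.map_apply measurable_snd hD]
  convert h D hD hb using 2
  ext z
  simp

/-- The sum of the two intensity measures is `σ`-finite, hence has a strictly positive integrable
function. -/
theorem exists_weight (P₀ P₁ : Law X) : ∃ w : X → ℝ≥0, (∀ x, 0 < w x) ∧ Measurable w ∧
    ∫⁻ ξ, ∫⁻ x, w x ∂ξ.toMeasure ∂P₀.measure ≤ 1 ∧
      ∫⁻ ξ, ∫⁻ x, w x ∂ξ.toMeasure ∂P₁.measure ≤ 1 := by
  have happ : ∀ (P : Law X) {D : Set X}, MeasurableSet D →
      (countingKernel X ∘ₘ P.measure) D = ∫⁻ ξ, ξ.toMeasure D ∂P.measure := fun P D hD =>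
    Measure.bind_apply hD (Kernel.aemeasurable _)
  have : SigmaFinite (countingKernel X ∘ₘ P₀.measure + countingKernel X ∘ₘ P₁.measure) :=
    sigmaFinite_of_isBounded fun D hD hb => by
      rw [Measure.add_apply, happ P₀ hD, happ P₁ hD]
      exact ENNReal.add_lt_top.2 ⟨P₀.locallyIntegrable D hD hb, P₁.locallyIntegrable D hD hb⟩
  obtain ⟨w, hw0, hw, hw1⟩ := exists_pos_lintegral_lt_of_sigmaFinite
    (countingKernel X ∘ₘ P₀.measure + countingKernel X ∘ₘ P₁.measure) one_ne_zero
  have hwm : Measurable fun x => (w x : ℝ≥0∞) := hw.coe_nnreal_ennreal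
  rw [lintegral_add_measure, Measure.lintegral_bind (Kernel.aemeasurable _) hwm.aemeasurable,
    Measure.lintegral_bind (Kernel.aemeasurable _) hwm.aemeasurable] at hw1
  exact ⟨w, hw0, hw, le_self_add.trans hw1.le, le_add_self.trans hw1.le⟩

/-- The difference `μ - ν` of possibly infinite measures is only encoded by an equation between
sums; the bounds `V.pos ≤ μ` and `V.neg ≤ ν` supply the integrability needed to rearrange it. -/
theorem Velocity.integral_eq (V : Velocity X) {μ ν : Measure (Config X × X)}
    (h : V.pos + ν = V.neg + μ) (hμ : V.pos ≤ μ) (hν : V.neg ≤ ν) {G : Config X × X → ℝ}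
    (hGμ : Integrable G μ) (hGν : Integrable G ν) :
    V.integral G = ∫ z, G z ∂μ - ∫ z, G z ∂ν := by
  have : ∫ z, G z ∂(V.pos + ν) = ∫ z, G z ∂(V.neg + μ) := by rw [h]
  rw [integral_add_measure (hGμ.mono_measure hμ) hGν,
    integral_add_measure (hGν.mono_measure hν) hGμ] at this
  rw [Velocity.integral]
  linarith

theorem Velocity.value_eq (V : Velocity X) {μ ν : Measure (Config X × X)}
    (h : V.pos + ν = V.neg + μ) (hμ : V.pos ≤ μ) (hν : V.neg ≤ ν) {S : Set (Config X × X)}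
    (hSμ : μ S ≠ ⊤) (hSν : ν S ≠ ⊤) : V.value S = (μ S).toReal - (ν S).toReal := by
  have := congrArg (fun m => (m S).toReal) h
  simp only [Measure.add_apply] at this
  rw [ENNReal.toReal_add (ne_top_of_le_ne_top hSμ (hμ S)) hSν,
    ENNReal.toReal_add (ne_top_of_le_ne_top hSν (hν S)) hSμ] at this
  rw [Velocity.value]
  linarith

variable [SecondCountableTopology X]

theorem lintegral_birthKernel_comp_snd (P₀ P₁ : Law X) (r : I × I) {w : X → ℝ≥0∞}
    (hw : Measurable w) :
    ∫⁻ z, w z.2 ∂birthKernel P₀ P₁ r = ∫⁻ ζ, ∫⁻ y, w y ∂ζ.toMeasure ∂P₁.measure := by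
  have hG : Measurable fun z : Config X × X => w z.2 := hw.comp measurable_snd
  rw [lintegral_birthKernel P₀ P₁ r hG]
  simp [birthIntegral]

theorem birthKernel_univ_prod_lt_top (P₀ P₁ : Law X) (r : I × I) {D : Set X}
    (hD : MeasurableSet D) (hb : Bornology.IsBounded D) :
    birthKernel P₀ P₁ r (univ ×ˢ D) < ⊤ := by
  rw [birthKernel_univ_prod P₀ P₁ r hD]
  exact P₁.locallyIntegrable D hD hb

/-- The birth mechanism along curves of retention probabilities, speeded up by `b`. -/
noncomputable def birthCurve (P₀ P₁ : Law X) {p q : ℝ → I} (hp : Measurable p) (hq : Measurable q)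
    {b : ℝ → ℝ≥0} (hb : Measurable b) : Kernel ℝ (Config X × X) where
  toFun t := b t • birthKernel P₀ P₁ (p t, q t)
  measurable' := Measure.measurable_of_measurable_coe _ fun s hs => by
    simp only [Measure.smul_apply]
    exact hb.smul ((Kernel.measurable_coe _ hs).comp (hp.prodMk hq))

/-- The weight depends on the spatial variable only, so its integral is controlled by the intensity
measures and the bound `C` on the speeds, uniformly in `t`. -/
theorem exists_velocityCurve (P₀ P₁ : Law X) {p q : ℝ → I} (hp : Measurable p) (hq : Measurable q)
    {a b : ℝ → ℝ≥0} (ha : Measurable a) (hb : Measurable b) {C : ℝ≥0} (haC : ∀ t, a t ≤ C)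
    (hbC : ∀ t, b t ≤ C) :
    ∃ pos neg : Kernel ℝ (Config X × X), ∀ t, pos t ⟂ₘ neg t ∧
      pos t + a t • birthKernel P₁ P₀ (q t, p t) = neg t + b t • birthKernel P₀ P₁ (p t, q t) ∧
      pos t ≤ b t • birthKernel P₀ P₁ (p t, q t) ∧ neg t ≤ a t • birthKernel P₁ P₀ (q t, p t) := by
  obtain ⟨w, hw0, hw, hw₀, hw₁⟩ := exists_weight P₀ P₁
  have hwm : Measurable fun x => (w x : ℝ≥0∞) := hw.coe_nnreal_ennreal
  refine exists_kernel_jordanDecomposition (birthCurve P₀ P₁ hp hq hb) (birthCurve P₁ P₀ hq hp ha)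
    (w := fun z => w z.2) (hwm.comp measurable_snd) (fun z => by simpa using (hw0 z.2).ne')
    (fun z => ENNReal.coe_ne_top) (C := C) ENNReal.coe_lt_top (fun t => ?_) (fun t => ?_)
  · change ∫⁻ z, w z.2 ∂(b t • birthKernel P₀ P₁ (p t, q t)) ≤ C
    rw [lintegral_smul_measure, lintegral_birthKernel_comp_snd _ _ _ hwm, ENNReal.smul_def, smul_eq_mul]
    exact (mul_le_mul' (ENNReal.coe_le_coe.2 (hbC t)) hw₁).trans_eq (mul_one _)
  · change ∫⁻ z, w z.2 ∂(a t • birthKernel P₁ P₀ (q t, p t)) ≤ C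
    rw [lintegral_smul_measure, lintegral_birthKernel_comp_snd _ _ _ hwm, ENNReal.smul_def, smul_eq_mul]
    exact (mul_le_mul' (ENNReal.coe_le_coe.2 (haC t)) hw₀).trans_eq (mul_one _)

end Velocity

/-! ### Retention schedules -/

section Schedule

/-- Away from `1/2`, the curve `p` either is differentiable with values in `(0,1)` and derivative
`a`, or is locally constant and `a` vanishes. -/
def DrivenBy (p : ℝ → I) (a : ℝ → ℝ) : Prop :=
  ∀ t ∈ Ioo (0 : ℝ) 1, t ≠ 1 / 2 →
    ((p t : ℝ) ∈ Ioo (0 : ℝ) 1 ∧ HasDerivAt (fun s => (p s : ℝ)) (a t) t) ∨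
      (a t = 0 ∧ ∀ᶠ s in 𝓝 t, p s = p t)

/-- The function `g` is known to be differentiable only inside `(0,1)`. Where `p` rests at an
endpoint, the composition is locally constant instead. -/
theorem DrivenBy.hasDerivAt_comp {p : ℝ → I} {a : ℝ → ℝ} (h : DrivenBy p a) {g g' : ℝ → ℝ}
    (hg : ∀ s ∈ Ioo (0 : ℝ) 1, HasDerivAt g (g' s) s) {t : ℝ} (ht : t ∈ Ioo (0 : ℝ) 1)
    (ht' : t ≠ 1 / 2) : HasDerivAt (fun s => g (p s)) (g' (p t) * a t) t := by
  rcases h t ht ht' with ⟨hp, hd⟩ | ⟨ha, hp⟩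
  · exact (hg _ hp).comp t hd
  · rw [ha, mul_zero]
    exact (hasDerivAt_const t (g (p t))).congr_of_eventuallyEq (hp.mono fun s hs => by simp only [hs])

/-- Time-dependent retention probabilities `p`, decreasing from `1` to `0` at speed `a`, and `q`,
increasing from `0` to `1` at speed `b`. -/
structure Schedule where
  (p q : ℝ → I)
  (a b : ℝ → ℝ≥0)
  continuous_p : Continuous p
  continuous_q : Continuous q
  measurable_a : Measurable a
  measurable_b : Measurable b
  a_le : ∀ t, a t ≤ 2
  b_le : ∀ t, b t ≤ 2
  p_zero : p 0 = 1
  p_one : p 1 = 0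
  q_zero : q 0 = 0
  q_one : q 1 = 1
  driven_p : DrivenBy p fun t => -(a t : ℝ)
  driven_q : DrivenBy q fun t => b t

/-- Thinning both configurations at the same time, at unit speed. -/
noncomputable def linearSchedule : Schedule where
  p t := σ (projIcc 0 1 zero_le_one t)
  q t := projIcc 0 1 zero_le_one t
  a _ := 1
  b _ := 1
  continuous_p := by fun_prop
  continuous_q := by fun_prop
  measurable_a := measurable_const
  measurable_b := measurable_const
  a_le _ := one_le_two
  b_le _ := one_le_two
  p_zero := by simp
  p_one := by simp
  q_zero := by simp
  q_one := by simp
  driven_p t ht _ := Or.inl <| by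
    have h : ∀ᶠ s in 𝓝 t, ((σ (projIcc 0 1 zero_le_one s) : I) : ℝ) = 1 - s := by
      filter_upwards [Ioo_mem_nhds ht.1 ht.2] with s hs
      rw [projIcc_of_mem _ (Ioo_subset_Icc_self hs), unitInterval.coe_symm_eq]
    refine ⟨by rw [h.self_of_nhds]; constructor <;> linarith [ht.1, ht.2], ?_⟩
    simpa using ((hasDerivAt_id t).const_sub 1).congr_of_eventuallyEq h
  driven_q t ht _ := Or.inl <| by
    have h : ∀ᶠ s in 𝓝 t, ((projIcc 0 1 zero_le_one s : I) : ℝ) = s := by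
      filter_upwards [Ioo_mem_nhds ht.1 ht.2] with s hs
      rw [projIcc_of_mem _ (Ioo_subset_Icc_self hs)]
    refine ⟨by rw [h.self_of_nhds]; exact ht, ?_⟩
    simpa using (hasDerivAt_id t).congr_of_eventuallyEq h

/-- Removing all points of the first configuration in the first half of the time interval and
adding those of the second one in the second half. -/
noncomputable def successiveSchedule : Schedule where
  -- Each stage takes time `1/2`, hence speed `2`; the projection keeps `p` at `0` after time `1/2`
  -- and `q` at `0` before it.
  p t := projIcc 0 1 zero_le_one (1 - 2 * t)
  q t := projIcc 0 1 zero_le_one (2 * t - 1)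
  a t := if t < 1 / 2 then 2 else 0
  b t := if t < 1 / 2 then 0 else 2
  continuous_p := by fun_prop
  continuous_q := by fun_prop
  measurable_a := Measurable.ite measurableSet_Iio measurable_const measurable_const
  measurable_b := Measurable.ite measurableSet_Iio measurable_const measurable_const
  a_le t := by split_ifs <;> simp
  b_le t := by split_ifs <;> simp
  p_zero := by simp
  p_one := projIcc_of_le_left _ (by norm_num)
  q_zero := projIcc_of_le_left _ (by norm_num)
  q_one := projIcc_of_right_le _ (by norm_num)
  driven_p t ht ht' := by
    rcases lt_or_gt_of_ne ht' with h | h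
    · left
      have he : ∀ᶠ s in 𝓝 t, ((projIcc 0 1 zero_le_one (1 - 2 * s) : I) : ℝ) = 1 - 2 * s := by
        filter_upwards [Ioo_mem_nhds ht.1 h] with s hs
        rw [projIcc_of_mem]
        constructor <;> linarith [hs.1, hs.2]
      refine ⟨by rw [he.self_of_nhds]; constructor <;> linarith [ht.1], ?_⟩
      simp only [if_pos h]
      simpa using (((hasDerivAt_id t).const_mul 2).const_sub 1).congr_of_eventuallyEq he
    · right
      refine ⟨by simp only [if_neg h.not_gt]; simp, ?_⟩
      filter_upwards [lt_mem_nhds h] with s hs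
      rw [projIcc_of_le_left _ (by linarith), projIcc_of_le_left _ (by linarith)]
  driven_q t ht ht' := by
    rcases lt_or_gt_of_ne ht' with h | h
    · right
      refine ⟨by simp only [if_pos h]; simp, ?_⟩
      filter_upwards [gt_mem_nhds h] with s hs
      rw [projIcc_of_le_left _ (by linarith), projIcc_of_le_left _ (by linarith)]
    · left
      have he : ∀ᶠ s in 𝓝 t, ((projIcc 0 1 zero_le_one (2 * s - 1) : I) : ℝ) = 2 * s - 1 := by
        filter_upwards [Ioo_mem_nhds h ht.2] with s hs
        rw [projIcc_of_mem]
        constructor <;> linarith [hs.1, hs.2]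
      refine ⟨by rw [he.self_of_nhds]; constructor <;> linarith [ht.2], ?_⟩
      simp only [if_neg h.not_gt]
      simpa using (((hasDerivAt_id t).const_mul 2).sub_const 1).congr_of_eventuallyEq he

/-- Hence any two configurations are compatible along this schedule, even if they share points. -/
theorem successiveSchedule_eq_zero (t : ℝ) :
    successiveSchedule.p t = 0 ∨ successiveSchedule.q t = 0 := by
  rcases le_total t (1 / 2) with h | h
  · exact Or.inr (projIcc_of_le_left zero_le_one (by linarith))
  · exact Or.inl (projIcc_of_le_left zero_le_one (by linarith))

end Schedule

/-! ### Solutions of the continuity equation -/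

section Existence

variable {X : Type*} [MetricSpace X] [MeasurableSpace X] [BorelSpace X]
  [SecondCountableTopology X]

/-- The thinnings of independent configurations never have a common point along the schedule. -/
def Schedule.Admissible (S : Schedule) (P₀ P₁ : Law X) : Prop :=
  ∀ t, ∀ᵐ c ∂(P₀.measure.prod P₁.measure), Compatible (S.p t) (S.q t) c.1 c.2

theorem ae_prod_swap {P₀ P₁ : Law X} {p q : I}
    (h : ∀ᵐ c ∂(P₀.measure.prod P₁.measure), Compatible p q c.1 c.2) :
    ∀ᵐ c ∂(P₁.measure.prod P₀.measure), Compatible q p c.1 c.2 := by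
  have hswap : Measure.QuasiMeasurePreserving Prod.swap (P₁.measure.prod P₀.measure)
      (P₀.measure.prod P₁.measure) := Measure.measurePreserving_swap.quasiMeasurePreserving
  exact (hswap.ae h).mono fun c hc => hc.symm

/-- The weak continuity equation for the product of two differentiable curves. -/
theorem integral_deriv_mul_add_mul_eq_zero {u W φ : ℝ → ℝ} (hu : Continuous u)
    (hW : IntegrableOn W (Icc 0 1)) (huW : ∀ t ∈ Ioo (0 : ℝ) 1, t ≠ 1 / 2 → HasDerivAt u (W t) t)
    (hφ : ContDiff ℝ (⊤ : ℕ∞) φ) (hsupp : tsupport φ ⊆ Ioo 0 1) :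
    (∫ t in (0 : ℝ)..1, deriv φ t * u t) + (∫ t in (0 : ℝ)..1, φ t * W t) = 0 := by
  have hφ' : Continuous (deriv φ) := hφ.continuous_deriv (by simp)
  have hdφ : Differentiable ℝ φ := hφ.differentiable (by simp)
  have h1 : IntervalIntegrable (fun t => deriv φ t * u t) volume 0 1 :=
    (hφ'.mul hu).intervalIntegrable _ _
  have hWi : IntervalIntegrable W volume 0 1 :=
    (intervalIntegrable_iff_integrableOn_Icc_of_le zero_le_one).2 hW
  have h2 : IntervalIntegrable (fun t => φ t * W t) volume 0 1 :=
    hWi.continuousOn_mul hφ.continuous.continuousOn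
  -- The two integrands sum to the derivative of `φ u` except at `1/2`, where a continuous primitive
  -- need not be differentiable.
  rw [← intervalIntegral.integral_add h1 h2,
    integral_eq_of_hasDerivAt_off_countable_of_le (fun t => φ t * u t)
      (fun t => deriv φ t * u t + φ t * W t) zero_le_one (countable_singleton (1 / 2 : ℝ))
      (hφ.continuous.mul hu).continuousOn
      (fun t ht => (hdφ t).hasDerivAt.mul (huW t ht.1 ht.2)) (h1.add h2)]
  have h0 : φ 0 = 0 := image_eq_zero_of_notMem_tsupport fun h => (lt_irrefl _ (hsupp h).1)
  have h1 : φ 1 = 0 := image_eq_zero_of_notMem_tsupport fun h => (lt_irrefl _ (hsupp h).2)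
  simp [h0, h1]

/-- Thinning along an admissible schedule solves the continuity equation. -/
theorem Schedule.exists_isSolution (S : Schedule) {P₀ P₁ : Law X} (hS : S.Admissible P₀ P₁) :
    ∃ V : ℝ → Velocity X, IsSolution P₀ P₁ (fun t => thinLaw P₀ P₁ (S.p t) (S.q t)) V ∧
      ∀ t, (V t).pos + S.a t • birthKernel P₁ P₀ (S.q t, S.p t) =
          (V t).neg + S.b t • birthKernel P₀ P₁ (S.p t, S.q t) ∧
        (V t).pos ≤ S.b t • birthKernel P₀ P₁ (S.p t, S.q t) ∧
        (V t).neg ≤ S.a t • birthKernel P₁ P₀ (S.q t, S.p t) := by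
  obtain ⟨pos, neg, h⟩ := exists_velocityCurve P₀ P₁ S.continuous_p.measurable
    S.continuous_q.measurable S.measurable_a S.measurable_b S.a_le S.b_le
  have fin₁ : ∀ t {D : Set X}, MeasurableSet D → Bornology.IsBounded D →
      (S.b t • birthKernel P₀ P₁ (S.p t, S.q t)) (univ ×ˢ D) < ⊤ := fun t D hD hb =>
    ENNReal.mul_lt_top ENNReal.coe_lt_top (birthKernel_univ_prod_lt_top P₀ P₁ _ hD hb)
  have fin₀ : ∀ t {D : Set X}, MeasurableSet D → Bornology.IsBounded D →
      (S.a t • birthKernel P₁ P₀ (S.q t, S.p t)) (univ ×ˢ D) < ⊤ := fun t D hD hb =>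
    ENNReal.mul_lt_top ENNReal.coe_lt_top (birthKernel_univ_prod_lt_top P₁ P₀ _ hD hb)
  let V : ℝ → Velocity X := fun t =>
    { pos := pos t
      neg := neg t
      mutuallySingular := (h t).1
      finite_pos := fun D hD hb => ((h t).2.2.1 _).trans_lt (fin₁ t hD hb)
      finite_neg := fun D hD hb => ((h t).2.2.2 _).trans_lt (fin₀ t hD hb) }
  -- The right-hand side is the derivative of `L₀ (p t) * L₁ (q t)` wherever `p` and `q` have
  -- derivatives `-a` and `b`, because `Law.thinLaplaceRate` is minus a derivative.
  have hV : ∀ (f : X → ℝ) (hf : IsTestFunction f) (hf0 : ∀ x, 0 ≤ f x) {D : Set X}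
      (hD : MeasurableSet D) (hb : Bornology.IsBounded D) (hfD : ∀ x, x ∉ D → f x = 0) (t : ℝ),
      (V t).integral (addOneCost (expFunctional f)) =
        S.a t * (P₀.thinLaplaceRate f hb (S.p t) * P₁.thinLaplace f hb (S.q t)) -
        S.b t * (P₀.thinLaplace f hb (S.p t) * P₁.thinLaplaceRate f hb (S.q t)) := by
    intro f hf hf0 D hD hb hfD t
    have hfm := hf.1.measurable
    rw [(V t).integral_eq (h t).2.1 (h t).2.2.1 (h t).2.2.2
      (integrable_addOneCost hfm hf0 hD hb hfD (fin₁ t hD hb))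
      (integrable_addOneCost hfm hf0 hD hb hfD (fin₀ t hD hb)),
      integral_smul_nnreal_measure, integral_smul_nnreal_measure,
      integral_birthKernel_addOneCost hfm hf0 hD hb hfD P₀ P₁ (hS t),
      integral_birthKernel_addOneCost hfm hf0 hD hb hfD P₁ P₀ (ae_prod_swap (hS t)),
      NNReal.smul_def, NNReal.smul_def, smul_eq_mul, smul_eq_mul]
    ring
  have hcp : ∀ {g : ℝ → ℝ}, ContinuousOn g (Icc 0 1) → Continuous fun t => g (S.p t) := fun hg =>
    hg.comp_continuous (by have := S.continuous_p; fun_prop) fun t => (S.p t).2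
  have hcq : ∀ {g : ℝ → ℝ}, ContinuousOn g (Icc 0 1) → Continuous fun t => g (S.q t) := fun hg =>
    hg.comp_continuous (by have := S.continuous_q; fun_prop) fun t => (S.q t).2
  have hint : ∀ f : X → ℝ, IsTestFunction f → (∀ x, 0 ≤ f x) →
      IntegrableOn (fun t => (V t).integral (addOneCost (expFunctional f))) (Icc 0 1) := by
    intro f hf hf0
    obtain ⟨D, hD, hb, hfD⟩ := hf.exists_measurableSet
    have hfm := hf.1.measurable
    simp_rw [hV f hf hf0 hD hb hfD]
    -- The speeds may jump, but they are measurable and bounded by `2`.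
    have bdd : ∀ {c : ℝ → ℝ≥0} {g : ℝ → ℝ}, Measurable c → (∀ t, c t ≤ 2) → Continuous g →
        IntegrableOn (fun t => (c t : ℝ) * g t) (Icc 0 1) := fun {c g} hc hc2 hg =>
      hg.integrableOn_Icc.bdd_mul hc.coe_nnreal_real.aestronglyMeasurable (c := 2)
        (Eventually.of_forall fun t => by
          rw [Real.norm_of_nonneg (c t).coe_nonneg]; exact_mod_cast hc2 t)
    exact (bdd S.measurable_a S.a_le
      ((hcp (continuousOn_law_thinLaplaceRate hfm hf0 hD hb hfD P₀)).mul
        (hcq (continuousOn_law_thinLaplace hfm hf0 hD hb hfD P₁)))).sub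
      (bdd S.measurable_b S.b_le ((hcp (continuousOn_law_thinLaplace hfm hf0 hD hb hfD P₀)).mul
        (hcq (continuousOn_law_thinLaplaceRate hfm hf0 hD hb hfD P₁))))
  refine ⟨V, ⟨?_, ?_, ?_, hint, ?_, ?_, ?_⟩, fun t => (h t).2⟩
  · rw [S.p_zero, S.q_zero, thinLaw_one_zero]
  · rw [S.p_one, S.q_one, thinLaw_zero_one]
  · exact fun t _ => tendsto_thinLaw S.continuous_p.continuousWithinAt
      S.continuous_q.continuousWithinAt P₀ P₁
  · intro f hf hf0 φ hφ _ hsupp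
    obtain ⟨D, hD, hb, hfD⟩ := hf.exists_measurableSet
    have hfm := hf.1.measurable
    have hu : ∀ t, ∫ ξ, expFunctional f ξ.toMeasure ∂(thinLaw P₀ P₁ (S.p t) (S.q t)).measure =
        P₀.thinLaplace f hb (S.p t) * P₁.thinLaplace f hb (S.q t) := fun t =>
      integral_expFunctional_thinLaw hfm hf0 hD hb hfD P₀ P₁ (hS t)
    simp_rw [hu]
    refine integral_deriv_mul_add_mul_eq_zero
      ((hcp (continuousOn_law_thinLaplace hfm hf0 hD hb hfD P₀)).mul
        (hcq (continuousOn_law_thinLaplace hfm hf0 hD hb hfD P₁))) (hint f hf hf0) ?_ hφ hsupp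
    intro t ht ht'
    have d₀ := S.driven_p.hasDerivAt_comp
      (fun s hs => hasDerivAt_law_thinLaplace hfm hf0 hD hb hfD P₀ hs) ht ht'
    have d₁ := S.driven_q.hasDerivAt_comp
      (fun s hs => hasDerivAt_law_thinLaplace hfm hf0 hD hb hfD P₁ hs) ht ht'
    refine (d₀.mul d₁).congr_deriv ?_
    rw [hV f hf hf0 hD hb hfD]
    ring
  · intro D hD _
    have hE : MeasurableSet ((univ : Set (Config X)) ×ˢ D) := MeasurableSet.univ.prod hD
    exact ((pos.measurable_coe hE).add (neg.measurable_coe hE)).aemeasurable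
  · intro D hD hb
    have hbound : ∀ t, (V t).totalVariation (univ ×ˢ D) ≤
        2 * ∫⁻ ξ, ξ.toMeasure D ∂P₁.measure + 2 * ∫⁻ ξ, ξ.toMeasure D ∂P₀.measure := by
      intro t
      refine add_le_add (((h t).2.2.1 _).trans ?_) (((h t).2.2.2 _).trans ?_)
      · rw [Measure.smul_apply, birthKernel_univ_prod _ _ _ hD]
        exact mul_le_mul_left (ENNReal.coe_le_coe.2 (S.b_le t)) _
      · rw [Measure.smul_apply, birthKernel_univ_prod _ _ _ hD]
        exact mul_le_mul_left (ENNReal.coe_le_coe.2 (S.a_le t)) _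
    refine (lintegral_mono hbound).trans_lt ?_
    rw [setLIntegral_const, Real.volume_Icc]
    exact ENNReal.mul_lt_top (ENNReal.add_lt_top.2
      ⟨ENNReal.mul_lt_top (by simp) (P₁.locallyIntegrable D hD hb),
        ENNReal.mul_lt_top (by simp) (P₀.locallyIntegrable D hD hb)⟩) ENNReal.ofReal_lt_top

theorem successiveSchedule_admissible (P₀ P₁ : Law X) :
    successiveSchedule.Admissible P₀ P₁ := fun t =>
  Eventually.of_forall fun _ => Or.inr (successiveSchedule_eq_zero t)

theorem AlmostSurelyDisjoint.admissible {P₀ P₁ : Law X} (h : AlmostSurelyDisjoint P₀ P₁)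
    (S : Schedule) : S.Admissible P₀ P₁ := fun _ => h.mono fun _ hc => Or.inl hc

theorem birthIntegral_indicator_prod {p q : I} {ξ ζ : Config X} (h : Disjoint ξ.carrier ζ.carrier)
    {K : Set (Measure X)} (hK : MeasurableSet K) {D : Set X} (hD : MeasurableSet D) :
    birthIntegral (p, q) (((Config.toMeasure ⁻¹' K) ×ˢ D).indicator 1) (ξ, ζ) =
      ∫⁻ y in D, thinnedSum p q ξ (ζ.erase y) K ∂ζ.toMeasure := by
  rw [birthIntegral, ← lintegral_indicator hD]
  refine lintegral_congr fun y => ?_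
  have hc : Compatible p q ξ (ζ.erase y) := Or.inl (h.mono_right inter_subset_left)
  have hKm := measurable_toMeasure hK
  by_cases hy : y ∈ D
  · rw [indicator_of_mem hy, thinnedSum_eq_map hc, Measure.map_apply measurable_toMeasure hK,
      ← lintegral_indicator_one hKm]
    refine lintegral_congr fun η => ?_
    by_cases hη : η ∈ Config.toMeasure ⁻¹' K
    · rw [indicator_of_mem (mk_mem_prod hη hy), indicator_of_mem hη]; rfl
    · rw [indicator_of_notMem (fun h => hη h.1), indicator_of_notMem hη]
  · rw [indicator_of_notMem hy]
    refine (lintegral_congr fun η => ?_).trans lintegral_zero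
    rw [indicator_of_notMem fun h => hy h.2]

/-- If the configurations are almost surely disjoint, then the thinning interpolation solves the
continuity equation. -/
theorem AlmostSurelyDisjoint.isThinningInterpolation {P₀ P₁ : Law X}
    (h : AlmostSurelyDisjoint P₀ P₁) {V : ℝ → Velocity X}
    (hV : ∀ t, (V t).pos + linearSchedule.a t •
          birthKernel P₁ P₀ (linearSchedule.q t, linearSchedule.p t) =
        (V t).neg + linearSchedule.b t •
          birthKernel P₀ P₁ (linearSchedule.p t, linearSchedule.q t) ∧
      (V t).pos ≤ linearSchedule.b t •
        birthKernel P₀ P₁ (linearSchedule.p t, linearSchedule.q t) ∧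
      (V t).neg ≤ linearSchedule.a t •
        birthKernel P₁ P₀ (linearSchedule.q t, linearSchedule.p t)) :
    IsThinningInterpolation P₀ P₁
      (fun t => thinLaw P₀ P₁ (linearSchedule.p t) (linearSchedule.q t)) V := by
  have hae := Measure.ae_ae_of_ae_prod h
  have hp : ∀ t : I, linearSchedule.p t = σ t := fun t => congrArg σ (projIcc_val zero_le_one t)
  have hq : ∀ t : I, linearSchedule.q t = t := fun t => projIcc_val zero_le_one t
  constructor
  · intro t K hK
    rw [thinLaw_apply _ _ _ _ (measurable_toMeasure hK), hp, hq]
    refine lintegral_congr_ae (hae.mono fun ξ hξ => lintegral_congr_ae (hξ.mono fun ζ hd => ?_))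
    simp only
    rw [thinnedSum_eq_map (Or.inl hd), Measure.map_apply measurable_toMeasure hK]
  · intro t K hK D hD hb
    have hs : MeasurableSet ((Config.toMeasure ⁻¹' K : Set (Config X)) ×ˢ D) :=
      (measurable_toMeasure hK).prod hD
    have hsub : (Config.toMeasure ⁻¹' K : Set (Config X)) ×ˢ D ⊆ univ ×ˢ D :=
      prod_mono_left (subset_univ _)
    have h1 := hV t
    simp only [show ∀ t, linearSchedule.a t = 1 from fun _ => rfl,
      show ∀ t, linearSchedule.b t = 1 from fun _ => rfl, one_smul, hp, hq] at h1
    rw [(V t).value_eq h1.1 h1.2.1 h1.2.2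
      ((measure_mono hsub).trans_lt (birthKernel_univ_prod_lt_top _ _ _ hD hb)).ne
      ((measure_mono hsub).trans_lt (birthKernel_univ_prod_lt_top _ _ _ hD hb)).ne,
      ← lintegral_indicator_one hs, ← lintegral_indicator_one hs,
      lintegral_birthKernel _ _ _ (measurable_one.indicator hs),
      lintegral_birthKernel_swap _ _ _ (measurable_one.indicator hs)]
    congr 2
    · refine lintegral_congr_ae (hae.mono fun ξ hξ => lintegral_congr_ae (hξ.mono fun ζ hd => ?_))
      exact birthIntegral_indicator_prod hd hK hD
    -- The death term is a birth term with exchanged roles, so the two thinnings must be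
    -- interchanged under the sum.
    · refine lintegral_congr_ae (hae.mono fun ξ hξ => lintegral_congr_ae (hξ.mono fun ζ hd => ?_))
      simp only
      rw [birthIntegral_indicator_prod hd.symm hK hD]
      exact lintegral_congr fun x => by rw [thinnedSum_comm]

end Existence

/-! ### Shifts and stationarity -/

section Shift

variable {E : Type*} [NormedAddCommGroup E]

theorem Config.shift_shift_neg (z : E) (ξ : Config E) : (ξ.shift z).shift (-z) = ξ := by
  ext x
  simp [Config.shift]

theorem Config.shift_erase (z y : E) (ξ : Config E) :
    (ξ.erase y).shift z = (ξ.shift z).erase (y - z) := by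
  ext x
  simp [Config.shift, Config.erase, Config.restrict, eq_sub_iff_add_eq]

variable [MeasurableSpace E] [BorelSpace E]

theorem Config.toMeasure_shift (z : E) (ξ : Config E) :
    (ξ.shift z).toMeasure = ξ.toMeasure.map fun x => x - z := by
  have hm : Measurable fun x : E => x - z := (continuous_id.sub continuous_const).measurable
  ext D hD
  rw [Measure.map_apply hm hD, Config.toMeasure_apply _ hD, Config.toMeasure_apply _ (hm hD),
    ← (add_left_injective z).encard_image]
  congr 2
  ext x
  simp only [Config.shift, mem_image, mem_inter_iff, mem_ofPred_eq, mem_preimage]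
  constructor
  · rintro ⟨y, ⟨hy, hyD⟩, rfl⟩
    exact ⟨hy, by simpa using hyD⟩
  · rintro ⟨hx, hxD⟩
    exact ⟨x - z, ⟨by simpa using hx, hxD⟩, by simp⟩

variable [SecondCountableTopology E]

theorem measurable_shift (z : E) : Measurable (Config.shift z : Config E → Config E) := by
  have hm : Measurable fun x : E => x - z := (continuous_id.sub continuous_const).measurable
  refine measurable_comap_iff.2 ?_
  have : Config.toMeasure ∘ Config.shift z =
      fun ξ : Config E => ξ.toMeasure.map fun x => x - z := funext (Config.toMeasure_shift z)
  rw [this]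
  exact (Measure.measurable_map _ hm).comp measurable_toMeasure

/-- Void probabilities depend only on counts, and the count of a shifted configuration in `D` is the
original count in the translate of `D`. -/
theorem thinUnion_shift (z : E) (p q : I) (ξ ζ : Config E) :
    thinUnion p q (ξ.shift z) (ζ.shift z) = (thinUnion p q ξ ζ).map (Config.shift z) := by
  have hm : Measurable fun x : E => x - z := (continuous_id.sub continuous_const).measurable
  have : IsProbabilityMeasure ((thinUnion p q ξ ζ).map (Config.shift z)) :=
    Measure.isProbabilityMeasure_map (measurable_shift z).aemeasurable
  refine ext_of_voidEvents fun D hD hb => ?_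
  have hb' : Bornology.IsBounded ((fun x => x - z) ⁻¹' D) := by
    have h := (LipschitzWith.of_dist_le_mul (K := 1) (f := fun x : E => x + z)
      (fun x y => by simp)).isBounded_image hb
    refine h.subset fun x hx => ⟨x - z, hx, by simp⟩
  have hcard : ∀ ξ : Config E, ((ξ.shift z).points hb).card = (ξ.points hb').card := by
    intro ξ
    have h := congrFun (congrArg DFunLike.coe (ξ.toMeasure_shift z)) D
    rw [Measure.map_apply hm hD, Config.toMeasure_eq_card _ hD hb,
      Config.toMeasure_eq_card _ (hm hD) hb'] at h
    exact_mod_cast h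
  have hpre : Config.shift z ⁻¹' voidEvent D = voidEvent ((fun x => x - z) ⁻¹' D) := by
    ext ξ
    rw [mem_preimage, voidEvent_eq_points hb, voidEvent_eq_points hb', mem_ofPred_eq,
      mem_ofPred_eq, hcard]
  rw [Measure.map_apply (measurable_shift z) (measurableSet_voidEvent hD), hpre,
    thinUnion_voidEvent _ _ _ _ hD hb, thinUnion_voidEvent _ _ _ _ (hm hD) hb', hcard, hcard]

theorem Law.IsStationary.lintegral_shift {P : Law E} (h : P.IsStationary) (z : E)
    {F : Config E → ℝ≥0∞} (hF : Measurable F) :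
    ∫⁻ ξ, F (ξ.shift z) ∂P.measure = ∫⁻ ξ, F ξ ∂P.measure := by
  conv_rhs => rw [← h z, lintegral_map hF (measurable_shift z)]

theorem lintegral_shift_shift {P₀ P₁ : Law E} (h₀ : P₀.IsStationary) (h₁ : P₁.IsStationary)
    (z : E) {F : Config E × Config E → ℝ≥0∞} (hF : Measurable F) :
    ∫⁻ ξ, ∫⁻ ζ, F (ξ.shift z, ζ.shift z) ∂P₁.measure ∂P₀.measure =
      ∫⁻ ξ, ∫⁻ ζ, F (ξ, ζ) ∂P₁.measure ∂P₀.measure := by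
  have h : ∀ ξ : Config E, ∫⁻ ζ, F (ξ.shift z, ζ.shift z) ∂P₁.measure =
      ∫⁻ ζ, F (ξ.shift z, ζ) ∂P₁.measure := fun ξ =>
    h₁.lintegral_shift z (F := fun ζ => F (ξ.shift z, ζ)) (hF.comp measurable_prodMk_left)
  simp_rw [h]
  exact h₀.lintegral_shift z hF.lintegral_prod_right'

theorem isStationary_thinLaw {P₀ P₁ : Law E} (h₀ : P₀.IsStationary) (h₁ : P₁.IsStationary)
    (p q : I) : (thinLaw P₀ P₁ p q).IsStationary := by
  intro z
  ext K hK
  rw [Measure.map_apply (measurable_shift z) hK, thinLaw_apply _ _ _ _ (measurable_shift z hK),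
    thinLaw_apply _ _ _ _ hK,
    ← lintegral_shift_shift h₀ h₁ z (F := fun c => thinUnion p q c.1 c.2 K)
      (Kernel.measurable_coe (thinPairKernel E p q) hK)]
  simp only [thinUnion_shift, Measure.map_apply (measurable_shift z) hK]

/-- The joint shift of a configuration and a point. -/
def shiftPair (z : E) (c : Config E × E) : Config E × E := (c.1.shift z, c.2 - z)

theorem measurable_shiftPair (z : E) : Measurable (shiftPair z : Config E × E → Config E × E) :=
  ((measurable_shift z).comp measurable_fst).prodMk
    ((continuous_id.sub continuous_const).measurable.comp measurable_snd)

theorem shiftPair_neg_shiftPair (z : E) (c : Config E × E) : shiftPair (-z) (shiftPair z c) = c := by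
  ext1
  · exact Config.shift_shift_neg z c.1
  · simp [shiftPair]

/-- Shifting moves the chosen point `y` to `y - z`, and both erasing and thinning commute with it.
-/
theorem birthIntegral_shift (z : E) (r : I × I) {G : Config E × E → ℝ≥0∞} (hG : Measurable G)
    (ξ ζ : Config E) :
    birthIntegral r (G ∘ shiftPair z) (ξ, ζ) = birthIntegral r G (ξ.shift z, ζ.shift z) := by
  have hm : Measurable fun x : E => x - z := (continuous_id.sub continuous_const).measurable
  have h1 : Measurable fun y => ∫⁻ η, G (η, y)
      ∂thinUnion r.1 r.2 (ξ.shift z) ((ζ.shift z).erase y) :=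
    (measurable_lintegral_thinErase r hG).comp (measurable_prodMk_left (x := (ξ.shift z, ζ.shift z)))
  rw [birthIntegral, birthIntegral]
  dsimp only
  rw [Config.toMeasure_shift, lintegral_map h1 hm]
  refine lintegral_congr fun y => ?_
  have h2 : Measurable fun η : Config E => G (η, y - z) := hG.comp measurable_prodMk_right
  rw [← Config.shift_erase, thinUnion_shift, lintegral_map h2 (measurable_shift z)]
  rfl

theorem birthKernel_map_shiftPair {P₀ P₁ : Law E} (h₀ : P₀.IsStationary) (h₁ : P₁.IsStationary)
    (z : E) (r : I × I) :
    (birthKernel P₀ P₁ r).map (shiftPair z) = birthKernel P₀ P₁ r := by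
  ext S hS
  have hi : Measurable (S.indicator (1 : Config E × E → ℝ≥0∞)) := measurable_one.indicator hS
  rw [← lintegral_indicator_one hS, ← lintegral_indicator_one hS,
    lintegral_map hi (measurable_shiftPair z), lintegral_birthKernel P₀ P₁ r hi,
    lintegral_birthKernel P₀ P₁ r (G := fun c => S.indicator 1 (shiftPair z c))
      (hi.comp (measurable_shiftPair z)),
    ← lintegral_shift_shift h₀ h₁ z (measurable_birthIntegral r hi)]
  refine lintegral_congr fun ξ => lintegral_congr fun ζ => birthIntegral_shift z r hi ξ ζ

/-- The shifted parts form a Jordan decomposition of the same difference `μ - ν`, so uniqueness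
identifies them with the original ones. -/
theorem Velocity.isStationary_of_add_eq_add {V : Velocity E} {μ ν : Measure (Config E × E)}
    [SigmaFinite μ] [SigmaFinite ν] (h : V.pos + ν = V.neg + μ)
    (hμ : ∀ z, μ.map (shiftPair z) = μ) (hν : ∀ z, ν.map (shiftPair z) = ν) :
    V.IsStationary := by
  intro z
  have hm := measurable_shiftPair z
  have hms : V.pos.map (shiftPair z) ⟂ₘ V.neg.map (shiftPair z) := by
    obtain ⟨S, hS, hp, hn⟩ := V.mutuallySingular
    have hS' := measurable_shiftPair (-z) hS
    have hpre : ∀ S : Set (Config E × E), shiftPair z ⁻¹' (shiftPair (-z) ⁻¹' S) = S := fun S => by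
      ext c
      simp only [mem_preimage, shiftPair_neg_shiftPair]
    refine ⟨shiftPair (-z) ⁻¹' S, hS', ?_, ?_⟩
    · rw [Measure.map_apply hm hS', hpre, hp]
    · rw [Measure.map_apply hm hS'.compl, preimage_compl, hpre, hn]
  refine jordanDecomposition_unique (μ := μ) (ν := ν) hms V.mutuallySingular ?_ h
  have := congrArg (fun m => m.map (shiftPair z)) h
  simp only [Measure.map_add _ _ hm, hμ, hν] at this
  exact this

/-- Thinning along an admissible schedule preserves stationarity. -/
theorem Schedule.isStationarySolution (S : Schedule) {P₀ P₁ : Law E} (h₀ : P₀.IsStationary)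
    (h₁ : P₁.IsStationary) {V : ℝ → Velocity E}
    (hsol : IsSolution P₀ P₁ (fun t => thinLaw P₀ P₁ (S.p t) (S.q t)) V)
    (hV : ∀ t, (V t).pos + S.a t • birthKernel P₁ P₀ (S.q t, S.p t) =
      (V t).neg + S.b t • birthKernel P₀ P₁ (S.p t, S.q t)) :
    IsStationarySolution P₀ P₁ (fun t => thinLaw P₀ P₁ (S.p t) (S.q t)) V := by
  refine ⟨hsol, fun t _ => ?_⟩
  have fin : ∀ (P₀ P₁ : Law E) (c : ℝ≥0) (r : I × I), SigmaFinite (c • birthKernel P₀ P₁ r) :=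
    fun P₀ P₁ c r => sigmaFinite_of_univ_prod fun D hD hb =>
      ENNReal.mul_lt_top ENNReal.coe_lt_top (birthKernel_univ_prod_lt_top P₀ P₁ r hD hb)
  have := fin P₀ P₁ (S.b t) (S.p t, S.q t)
  have := fin P₁ P₀ (S.a t) (S.q t, S.p t)
  refine Velocity.isStationary_of_add_eq_add (hV t) (fun z => ?_) fun z => ?_
  · rw [Measure.map_smul, birthKernel_map_shiftPair h₀ h₁]
  · rw [Measure.map_smul, birthKernel_map_shiftPair h₁ h₀]

variable [NormedSpace ℝ E] [Nontrivial E]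

/-- The intensity measure of a stationary point process has no atoms. -/
theorem Law.IsStationary.lintegral_singleton {P : Law E} (h : P.IsStationary) (x : E) :
    ∫⁻ ζ, ζ.toMeasure {x} ∂P.measure = 0 := by
  have hconst : ∀ y, ∫⁻ ζ, ζ.toMeasure {y} ∂P.measure = ∫⁻ ζ, ζ.toMeasure {x} ∂P.measure := by
    intro y
    rw [← h.lintegral_shift (y - x) (measurable_toMeasure_apply (measurableSet_singleton x))]
    have hm : Measurable fun w : E => w - (y - x) :=
      (continuous_id.sub continuous_const).measurable
    refine lintegral_congr fun ζ => ?_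
    rw [Config.toMeasure_shift, Measure.map_apply hm (measurableSet_singleton x)]
    congr 1
    ext w
    simp [sub_eq_iff_eq_add]
  obtain ⟨v, hv⟩ := exists_ne (0 : E)
  -- A bounded sequence of distinct points: by stationarity they all carry the same mass, and the
  -- sum of the masses is finite.
  let u : ℕ → E := fun n => (1 / ((n : ℝ) + 1)) • v
  have hinj : Function.Injective u := fun m n hmn => by
    have := smul_left_injective ℝ hv hmn
    simpa using this
  have hb : Bornology.IsBounded (range u) := by
    refine (Metric.isBounded_closedBall (x := (0 : E)) (r := ‖v‖)).subset ?_
    rintro _ ⟨n, rfl⟩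
    rw [mem_closedBall_zero_iff, norm_smul, Real.norm_of_nonneg (by positivity)]
    refine mul_le_of_le_one_left (norm_nonneg v) ?_
    rw [div_le_one (by positivity)]
    linarith [(Nat.cast_nonneg n : (0 : ℝ) ≤ n)]
  have hfin := P.locallyIntegrable _ (countable_range u).measurableSet hb
  have hsum : ∀ ζ : Config E, ζ.toMeasure (range u) = ∑' n, ζ.toMeasure {u n} := fun ζ => by
    rw [← iUnion_singleton_eq_range, measure_iUnion
      (fun m n hmn => disjoint_singleton.2 (hinj.ne hmn)) fun n => measurableSet_singleton _]
  simp_rw [hsum] at hfin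
  rw [lintegral_tsum fun n =>
    (measurable_toMeasure_apply (measurableSet_singleton _)).aemeasurable] at hfin
  simp_rw [hconst] at hfin
  by_contra hne
  exact hfin.ne (ENNReal.tsum_const_eq_top_of_ne_zero hne)

theorem measurable_toMeasure_singleton :
    Measurable fun c : Config E × E => c.1.toMeasure {c.2} := by
  let κ : Kernel (Config E × E) E := (countingKernel E).comap Prod.fst measurable_fst
  let s : Set ((Config E × E) × E) := {c | c.2 = c.1.2}
  have hs : MeasurableSet s :=
    measurableSet_eq_fun measurable_snd (measurable_snd.comp measurable_fst)
  have h : Measurable fun c : Config E × E => κ c (Prod.mk c ⁻¹' s) :=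
    Kernel.measurable_kernel_prodMk_left hs
  exact h

theorem measurable_lintegral_toMeasure_fst {g : Config E × E → ℝ≥0∞} (hg : Measurable g) :
    Measurable fun c : Config E × Config E => ∫⁻ x, g (c.2, x) ∂c.1.toMeasure := by
  let κ : Kernel (Config E × Config E) E := (countingKernel E).comap Prod.fst measurable_fst
  have hp : Measurable fun d : (Config E × Config E) × E => (d.1.2, d.2) :=
    (measurable_snd.comp measurable_fst).prodMk measurable_snd
  have h : Measurable fun c => ∫⁻ x, g (c.2, x) ∂κ c :=
    (hg.comp hp).lintegral_kernel_prod_right'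
  exact h

/-- Independent stationary point processes almost surely have no common point. -/
theorem Law.IsStationary.almostSurelyDisjoint {P₀ P₁ : Law E} (h₁ : P₁.IsStationary) :
    AlmostSurelyDisjoint P₀ P₁ := by
  -- `N` counts common points. By Tonelli its mean is an integral of masses that the intensity
  -- measure of `P₁` gives to single points.
  let N : Config E × Config E → ℝ≥0∞ := fun c => ∫⁻ x, c.2.toMeasure {x} ∂c.1.toMeasure
  have hN : Measurable N :=
    measurable_lintegral_toMeasure_fst measurable_toMeasure_singleton
  have h0 : ∫⁻ c, N c ∂(P₀.measure.prod P₁.measure) = 0 := by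
    rw [lintegral_prod _ hN.aemeasurable]
    refine (lintegral_congr fun ξ => ?_).trans lintegral_zero
    have hm : Measurable fun c : Config E × E => c.1.toMeasure {c.2} :=
      measurable_toMeasure_singleton
    have hswap := lintegral_lintegral_swap (μ := P₁.measure) (ν := ξ.toMeasure)
      (f := fun (ζ : Config E) x => ζ.toMeasure {x}) hm.aemeasurable
    refine hswap.trans ((lintegral_congr fun x => ?_).trans lintegral_zero)
    exact h₁.lintegral_singleton x
  rw [lintegral_eq_zero_iff hN] at h0
  refine h0.mono fun c hc => disjoint_left.2 fun x hx hx' => ?_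
  have hc : ∫⁻ x, c.2.toMeasure {x} ∂c.1.toMeasure = 0 := hc
  rw [Config.lintegral_toMeasure, ENNReal.tsum_eq_zero] at hc
  exact disjoint_left.1 ((Config.toMeasure_eq_zero_iff _ (measurableSet_singleton x)).1 (hc ⟨x, hx⟩))
    hx' (mem_singleton x)

end Shift

end PointProcess

/-! ### The main theorem -/

theorem mainTheorem1 (d : ℕ) :
    (∀ (B : Set (EuclideanSpace ℝ (Fin d))) [PolishSpace B] (P₀ P₁ : PointProcess.Law B),
      ∃ (P : ℝ → PointProcess.Law B) (V : ℝ → PointProcess.Velocity B),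
        PointProcess.IsSolution P₀ P₁ P V ∧
        (PointProcess.AlmostSurelyDisjoint P₀ P₁ →
          PointProcess.IsThinningInterpolation P₀ P₁ P V)) ∧
    (∀ P₀ P₁ : PointProcess.Law (EuclideanSpace ℝ (Fin d)),
      P₀.IsStationary → P₁.IsStationary →
      ∃ (P : ℝ → PointProcess.Law (EuclideanSpace ℝ (Fin d)))
        (V : ℝ → PointProcess.Velocity (EuclideanSpace ℝ (Fin d))),
        PointProcess.IsStationarySolution P₀ P₁ P V ∧
        (∀ t ∈ Set.Icc (0 : ℝ) 1, (P t).IsStationary) ∧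
        (0 < d → PointProcess.IsThinningInterpolation P₀ P₁ P V)) := by
  open PointProcess in
  constructor
  · intro B _ P₀ P₁
    by_cases h : AlmostSurelyDisjoint P₀ P₁
    · obtain ⟨V, hsol, hV⟩ := linearSchedule.exists_isSolution (h.admissible linearSchedule)
      exact ⟨_, V, hsol, fun h => h.isThinningInterpolation hV⟩
    · obtain ⟨V, hsol, -⟩ := successiveSchedule.exists_isSolution
        (successiveSchedule_admissible P₀ P₁)
      exact ⟨_, V, hsol, fun h' => absurd h' h⟩
  · intro P₀ P₁ h₀ h₁
    -- For `d = 0` the space is one point, every law is stationary and common points can occur, so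
    -- the successive schedule is needed.
    rcases Nat.eq_zero_or_pos d with hd | hd
    · obtain ⟨V, hsol, hV⟩ := successiveSchedule.exists_isSolution
        (successiveSchedule_admissible P₀ P₁)
      exact ⟨_, V, successiveSchedule.isStationarySolution h₀ h₁ hsol fun t => (hV t).1,
        fun t _ => isStationary_thinLaw h₀ h₁ _ _, fun h => absurd hd h.ne'⟩
    · have : Nonempty (Fin d) := ⟨⟨0, hd⟩⟩
      have hdis : AlmostSurelyDisjoint P₀ P₁ := h₁.almostSurelyDisjoint
      obtain ⟨V, hsol, hV⟩ := linearSchedule.exists_isSolution (hdis.admissible linearSchedule)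
      exact ⟨_, V, linearSchedule.isStationarySolution h₀ h₁ hsol fun t => (hV t).1,
        fun t _ => isStationary_thinLaw h₀ h₁ _ _, fun _ => hdis.isThinningInterpolation hV⟩
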